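/- **Setting.** Let $d,K\ge 1$. Let $\mathcal S\subseteq\mathbb R^d$, and let $\vec S_0,\vec S_1,\dots,\vec S_K$ be an $\mathcal S$-valued process on a filtered probability space, Markov with respect to the filtration, with deterministic $\vec S_0$ and with transition laws $p_{k+1}(\cdot\,;\vec s)$ of $\vec S_{k+1}$ given $\vec S_k=\vec s$, defined and supported on finitely many points for every $\vec s\in\mathcal S$ and $0\le k\le K-1$. Let $f_k:\mathcal S\to\mathbb R$, $1\le k\le K$, be measurable payoffs. The present price of the Bermudan option is $V_0=\sup_\tau\mathbb E[f_\tau(\vec S_\tau)]$ over $\{1,\dots,K\}$-valued stopping times $\tau$, and $V_k(\vec s)=\sup_\tau\mathbb E[f_\tau(\vec S_\tau)\mid \vec S_k=\vec s]$ over $\{k,\dots,K\}$-valued stopping times. **Out-of-boundary approximation.** For every $1\le k\le K-1$ we are given a hyper-rectangle $\mathcal D_k=\prod_{i=1}^d[L_{i,k},U_{i,k}]\subseteq\mathcal S$ with $L_{i,k}<U_{i,k}$, a set $\mathcal A_k\subseteq\mathcal S\setminus\mathcal D_k$, a function $V^{\rm OB}_k$ on $\mathcal S\setminus\mathcal D_k$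 and $\epsilon^{\rm OB}_k\ge 0$. Let $b_k(\vec s)=(\min\{U_{i,k},\max\{L_{i,k},s_i\}\})_{i}$. Assume $|V^{\rm OB}_k(\vec s)-V_k(\vec s)|<\epsilon^{\rm OB}_k$ for $\vec s\in\mathcal A_k$ and $|V_k(b_k(\vec s))-V_k(\vec s)|<\epsilon^{\rm OB}_k$ for $\vec s\in(\mathcal S\setminus\mathcal D_k)\setminus\mathcal A_k$. For $H:\mathcal D_k\to\mathbb R$ put $\mathbf G_k[H](\vec s)=V^{\rm OB}_k(\vec s)$ if $\vec s\in\mathcal A_k$, and $\mathbf G_k[H](\vec s)=H(b_k(\vec s))$ otherwise; put $\mathbf G_K[H]=H$. **Algorithm.** Let $m_k\ge 1$ and $\mathcal J_k=\{0,\dots,m_k\}^d$ for $1\le k\le K-1$, and let $\vec x_{k,\vec j}\in\mathcal D_k$, $\vec j\in\mathcal J_k$, be the tensor Chebyshev nodes, $(\vec x_{k,\vec j})_i=\frac{U_{i,k}-L_{i,k}}2\cos\bigl(\frac{j_i+1/2}{m_k+1}\pi\bigr)+\frac{U_{i,k}+L_{i,k}}2$. Put $\widetilde V_K=f_K$. For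 $k=K-1,\dots,1$ let $$\widehat Q_k(\vec s)=\mathbb E\bigl[\mathbf G_{k+1}[\widetilde V_{k+1}](\vec S_{k+1})\mid\vec S_k=\vec s\bigr],\qquad \vec s\in\mathcal S,$$ let $\widehat Q^{\rm QAE}_{k,\vec j}=(2\widetilde P_{k,\vec j}-1)\widetilde V^{\max}_{k+1}$ be the estimates of $\widehat Q_k(\vec x_{k,\vec j})$ obtained from quantum amplitude estimation (QAE; $\widetilde P_{k,\vec j}$ is its output and $\widetilde V^{\max}_{k+1}$ a normalization constant), let $\widetilde Q_k$ be the tensor Chebyshev interpolant of degree $m_k$ in each variable on $\mathcal D_k$ that takes the values $\widehat Q^{\rm QAE}_{k,\vec j}$ at the nodes $\vec x_{k,\vec j}$, and let $\widetilde V_k=\max\{f_k,\widetilde Q_k\}$ on $\mathcal D_k$. Let $\widehat V_0=\mathbb E[\mathbf G_1[\widetilde V_1](\vec S_1)]$, and let $\widetilde V_0=(2\widetilde P_0-1)\widetilde V^{\max}_1$ be its estimate from QAE, which is the output of the algorithm. **Analyticity.** For every $1\le k\le K-1$ assume that there are $\widehat\rho_k>1$ and $\widehat B_k$ such that $\widehat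 Q_k|_{\mathcal D_k}$ has an analytic extension, bounded by $\widehat B_k$ in modulus, to the generalized Bernstein ellipse $\prod_{i=1}^d\eta_{i,k}(\mathcal B_{\widehat\rho_k})\subseteq\mathbb C^d$, where $\eta_{i,k}(z)=\frac{U_{i,k}-L_{i,k}}2z+\frac{U_{i,k}+L_{i,k}}2$ and $\mathcal B_\rho$ is the open region bounded by the ellipse $\{\frac12(u+u^{-1}):|u|=\rho\}$. **Theorem.** Suppose that $|\widehat Q_k(\vec x_{k,\vec j})-\widehat Q^{\rm QAE}_{k,\vec j}|\le\epsilon^{\rm QAE}_k$ for every $1\le k\le K-1$ and $\vec j\in\mathcal J_k$, and that $|\widehat V_0-\widetilde V_0|\le\epsilon^{\rm QAE}_0$. Then $$|V_0-\widetilde V_0|\le\sum_{k=1}^{K-1}\epsilon^{\rm OB}_k+\sum_{k=1}^{K-1}\widetilde\epsilon^{\rm int}_k+\sum_{k=0}^{K-1}\Lambda_k\epsilon^{\rm QAE}_k,$$ where $\widetilde\epsilon^{\rm int}_k=2^{d/2+1}\sqrt d\,\widehat B_k\,\widehat\rho_k^{\,-m_k}(1-\widehat\rho_k^{\,-2})^{-d/2}$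 and $\Lambda_k=\bigl(\frac2\pi\log(m_k+1)+1\bigr)^d$ for $1\le k\le K-1$, and $\Lambda_0=1$. -/

import Mathlib

open MeasureTheory ProbabilityTheory
open scoped ENNReal

noncomputable section

namespace Bermudan

/-! ### Chebyshev interpolation on hyper-rectangles -/

/-- A nondegenerate hyper-rectangle `[L₁, U₁] × ⋯ × [L_d, U_d]`. -/
structure Box (d : ℕ) where
  /-- lower corner -/
  L : Fin d → ℝ
  /-- upper corner -/
  U : Fin d → ℝ
  lt : ∀ i, L i < U i

/-- The `j`-th zero of the Chebyshev polynomial `T_{m+1}`, for `j = 0, …, m`. -/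
def chebNode (m : ℕ) (j : Fin (m + 1)) : ℝ :=
  Real.cos (((j : ℝ) + 1 / 2) / ((m : ℝ) + 1) * Real.pi)

namespace Box

variable {d : ℕ} (D : Box d)

/-- The points of the hyper-rectangle. -/
def toSet : Set (Fin d → ℝ) := {s | ∀ i, D.L i ≤ s i ∧ s i ≤ D.U i}

/-- The affine map that sends the hyper-rectangle onto `[-1, 1]^d`. -/
def theta (s : Fin d → ℝ) (i : Fin d) : ℝ :=
  (2 * s i - D.U i - D.L i) / (D.U i - D.L i)

/-- The tensorized Chebyshev polynomial of multi-degree `l`. -/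
def chebTensor (l : Fin d → ℕ) (s : Fin d → ℝ) : ℝ :=
  ∏ i, (Polynomial.Chebyshev.T ℝ (l i : ℤ)).eval (D.theta s i)

/-- The Chebyshev node with multi-index `j`, transported to the hyper-rectangle. -/
def node (m : ℕ) (j : Fin d → Fin (m + 1)) (i : Fin d) : ℝ :=
  (D.U i - D.L i) / 2 * chebNode m (j i) + (D.U i + D.L i) / 2

theorem node_mem (m : ℕ) (j : Fin d → Fin (m + 1)) : D.node m j ∈ D.toSet := by
  intro i
  have h := D.lt i
  have h1 := Real.neg_one_le_cos (((j i : ℝ) + 1 / 2) / ((m : ℝ) + 1) * Real.pi)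
  have h2 := Real.cos_le_one (((j i : ℝ) + 1 / 2) / ((m : ℝ) + 1) * Real.pi)
  simp only [node, chebNode]
  constructor <;> nlinarith

/-- The coefficient of multi-index `l` of the Chebyshev interpolant of the values `v` given at
the nodes. -/
def chebCoeff (m : ℕ) (v : (Fin d → Fin (m + 1)) → ℝ) (l : Fin d → Fin (m + 1)) : ℝ :=
  2 ^ (Finset.univ.filter fun i => 0 < (l i : ℕ)).card / ((m : ℝ) + 1) ^ d *
    ∑ j : Fin d → Fin (m + 1), v j * D.chebTensor (fun i => (l i : ℕ)) (D.node m j)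

/-- The Chebyshev interpolant, of degree `m` in each variable, of the values `v` given at the
nodes. -/
def chebInterp (m : ℕ) (v : (Fin d → Fin (m + 1)) → ℝ) (s : Fin d → ℝ) : ℝ :=
  ∑ l : Fin d → Fin (m + 1), D.chebCoeff m v l * D.chebTensor (fun i => (l i : ℕ)) s

/-- The nearest point `b(s)` of the hyper-rectangle, coordinate by coordinate. -/
def clamp (s : Fin d → ℝ) (i : Fin d) : ℝ := min (D.U i) (max (D.L i) (s i))

theorem clamp_mem (s : Fin d → ℝ) : D.clamp s ∈ D.toSet := fun i =>
  ⟨le_min (D.lt i).le (le_max_left _ _), min_le_left _ _⟩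

end Box

/-- The Bernstein ellipse: the open region bounded by the ellipse
`{(u + u⁻¹) / 2 : |u| = ρ}`, written as the image of the open annulus `ρ⁻¹ < |u| < ρ` under
`u ↦ (u + u⁻¹) / 2`. -/
def bernsteinEllipse (ρ : ℝ) : Set ℂ :=
  {z | ∃ u : ℂ, ρ⁻¹ < ‖u‖ ∧ ‖u‖ < ρ ∧ z = (u + u⁻¹) / 2}

/-- The generalized Bernstein ellipse around a hyper-rectangle. -/
def Box.bernstein {d : ℕ} (D : Box d) (ρ : ℝ) : Set (Fin d → ℂ) :=
  {z | ∀ i, ∃ w ∈ bernsteinEllipse ρ,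
    z i = ((D.U i : ℂ) - (D.L i : ℂ)) / 2 * w + ((D.U i : ℂ) + (D.L i : ℂ)) / 2}

/-- `g`, a function on the hyper-rectangle `D`, has an analytic extension to the generalized
Bernstein ellipse of parameter `ρ` that is bounded there by `B` in modulus. -/
def HasBoundedAnalyticExtension {d : ℕ} (D : Box d) (ρ B : ℝ) (g : D.toSet → ℝ) : Prop :=
  ∃ F : (Fin d → ℂ) → ℂ, AnalyticOnNhd ℂ F (D.bernstein ρ) ∧
    (∀ s : D.toSet, F (fun i => ((s : Fin d → ℝ) i : ℂ)) = (g s : ℂ)) ∧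
    ∀ z ∈ D.bernstein ρ, ‖F z‖ ≤ B

/-- The interpolation error term `ε^int(ρ, d, m, B)`. -/
def epsInt (ρ : ℝ) (d m : ℕ) (B : ℝ) : ℝ :=
  2 ^ ((d : ℝ) / 2 + 1) * √(d : ℝ) * B * (ρ ^ m)⁻¹ * (1 - (ρ ^ 2)⁻¹) ^ (-((d : ℝ) / 2))

/-- The factor `(2/π · log (m+1) + 1)^d`. -/
def lebesgueFactor (d m : ℕ) : ℝ :=
  (2 / Real.pi * Real.log ((m : ℝ) + 1) + 1) ^ d

/-! ### Bermudan options -/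

/-- A Bermudan option on `d` underlying assets with exercise dates `1, …, K`: the state space
`𝒮 ⊆ ℝ^d`, the transition kernels of the underlying Markov process (`step k` is the law of
`S_{k+1}` conditional on `S_k`, charging finitely many points) and the payoffs. -/
structure Market (d K : ℕ) where
  /-- the state space `𝒮` -/
  space : Set (Fin d → ℝ)
  /-- the transition law from date `k` to date `k + 1` -/
  step : ℕ → Kernel space space
  markov : ∀ k, IsMarkovKernel (step k)
  finite_step : ∀ k < K, ∀ s : space, ∃ A : Finset space, step k s ((A : Set space)ᶜ) = 0
  /-- the payoff from exercise at date `k` -/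
  payoff : ℕ → space → ℝ
  measurable_payoff : ∀ k, 1 ≤ k → k ≤ K → Measurable (payoff k)

/-- The supremum of `𝔼[f_τ(X_τ)]` over the `{k, …, K}`-valued stopping times `τ`. -/
def stoppingValue {Ω E : Type*} {mΩ : MeasurableSpace Ω} (μ : Measure Ω) (ℱ : Filtration ℕ mΩ)
    (X : ℕ → Ω → E) (f : ℕ → E → ℝ) (k K : ℕ) : ℝ :=
  sSup {v | ∃ τ : Ω → ℕ, IsStoppingTime ℱ (fun ω => (τ ω : WithTop ℕ)) ∧
    (∀ ω, k ≤ τ ω ∧ τ ω ≤ K) ∧ v = ∫ ω, f (τ ω) (X (τ ω) ω) ∂μ}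

namespace Market

variable {d K : ℕ} (M : Market d K)

/-- The transition law from date `n` to date `n + 1`, as a kernel from the history. -/
def historyStep (n : ℕ) : Kernel (Π _ : Finset.Iic n, M.space) M.space :=
  (M.step n).comap (fun h => h ⟨n, Finset.mem_Iic.2 le_rfl⟩) (measurable_pi_apply _)

instance (n : ℕ) : IsMarkovKernel (M.historyStep n) := by
  have := M.markov n
  unfold historyStep
  infer_instance

/-- The law, on path space, of the Markov chain started from `s` at date `k` (the coordinates
before `k` are irrelevant and are set to `s`). -/
def pathLaw (k : ℕ) (s : M.space) : Measure (ℕ → M.space) :=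
  Kernel.traj (X := fun _ => M.space) M.historyStep k (fun _ => s)

/-- The option price `V_k(s)` at date `k`, conditional on `S_k = s`. -/
def value (k : ℕ) (s : M.space) : ℝ :=
  stoppingValue (M.pathLaw k s) (Filtration.piLE (X := fun _ => M.space)) (fun n x => x n)
    M.payoff k K

/-- `S`, on the filtered probability space `(Ω, ℱ, μ)`, is a Markov process with the transition
laws of `M` started from the deterministic point `s₀`. -/
structure IsPriceModel {Ω : Type*} {mΩ : MeasurableSpace Ω} (μ : Measure Ω)
    (ℱ : Filtration ℕ mΩ) (S : ℕ → Ω → M.space) (s₀ : M.space) : Prop where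
  adapted : ∀ n ≤ K, Measurable[ℱ n] (S n)
  init : ∀ᵐ ω ∂μ, S 0 ω = s₀
  markov_property : ∀ n < K, ∀ A : Set M.space, MeasurableSet A →
    μ[(S (n + 1) ⁻¹' A).indicator (fun _ => (1 : ℝ)) | ℱ n] =ᵐ[μ]
      fun ω => (M.step n (S n ω)).real A

end Market

/-! ### The algorithm -/

/-- The inputs of the pricing algorithm and the (classical) outputs of its quantum amplitude
estimations. -/
structure Run {d K : ℕ} (M : Market d K) where
  /-- the hyper-rectangle for interpolation at date `k`, for `1 ≤ k < K` -/
  D : ℕ → Box d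
  subset : ∀ k, 1 ≤ k → k < K → (D k).toSet ⊆ M.space
  /-- the region outside `D k` in which `VOB k` is used -/
  A : ℕ → Set M.space
  A_outside : ∀ k, 1 ≤ k → k < K → ∀ s ∈ A k, (s : Fin d → ℝ) ∉ (D k).toSet
  /-- the given out-of-boundary approximation of `V_k` (only its values outside `D k` matter) -/
  VOB : ℕ → M.space → ℝ
  /-- the degree of the interpolation at date `k` -/
  m : ℕ → ℕ
  m_pos : ∀ k, 1 ≤ k → k < K → 0 < m k
  /-- the normalization constants `Ṽ_k^max` -/
  Vmax : ℕ → ℝ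
  /-- the estimate, obtained at date `k` for the node `x_j` with multi-index `j`, of the probability
  `1/2 + Q̂_k(x_j) / (2 Ṽ_{k+1}^max)`; it is any real number, its accuracy being a hypothesis where
  one is needed -/
  P : ∀ k, (Fin d → Fin (m k + 1)) → ℝ
  /-- the estimate, in the last step, of the probability
  `1/2 + 𝔼[𝐆_1[Ṽ_1](S_1)] / (2 Ṽ_1^max)` -/
  P₀ : ℝ

namespace Run

variable {d K : ℕ} {M : Market d K} (R : Run M)

/-- The inclusion of the hyper-rectangle at date `k` into the state space. -/
def incl {k : ℕ} (hk : 1 ≤ k ∧ k < K) (s : (R.D k).toSet) : M.space :=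
  ⟨s, R.subset k hk.1 hk.2 s.2⟩

/-- The nearest point `b_k(s)` of the hyper-rectangle at date `k`. -/
def clamp (k : ℕ) (s : M.space) : (R.D k).toSet := ⟨(R.D k).clamp s, (R.D k).clamp_mem s⟩

/-- The flat extrapolation `𝐅_k[H]`. -/
def flat (k : ℕ) (H : (R.D k).toSet → ℝ) (s : M.space) : ℝ := H (R.clamp k s)

open Classical in
/-- The extrapolation `𝐆_k[H]`, for `1 ≤ k < K`. -/
def extrap (k : ℕ) (H : (R.D k).toSet → ℝ) (s : M.space) : ℝ :=
  if s ∈ R.A k then R.VOB k s else R.flat k H s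

/-- The estimate of the approximate continuation value at a node. -/
def QQAE (k : ℕ) (j : Fin d → Fin (R.m k + 1)) : ℝ := (2 * R.P k j - 1) * R.Vmax (k + 1)

/-- The interpolated continuation value `Q̃_k`. -/
def Qtilde (k : ℕ) (s : (R.D k).toSet) : ℝ := (R.D k).chebInterp (R.m k) (R.QQAE k) s

/-- The approximate option value `Ṽ_k` on the hyper-rectangle, for `1 ≤ k < K`. -/
def Vtilde {k : ℕ} (hk : 1 ≤ k ∧ k < K) (s : (R.D k).toSet) : ℝ :=
  max (M.payoff k (R.incl hk s)) (R.Qtilde k s)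

/-- `𝐆_k[Ṽ_k]` on the whole state space, for `1 ≤ k ≤ K`; it is the payoff at `k = K`. -/
def GV (k : ℕ) (s : M.space) : ℝ :=
  if hk : 1 ≤ k ∧ k < K then R.extrap k (R.Vtilde hk) s else M.payoff k s

/-- `Q̂_k(s) = 𝔼[𝐆_{k+1}[Ṽ_{k+1}](S_{k+1}) | S_k = s]`. -/
def Qhat (k : ℕ) (s : M.space) : ℝ := ∫ s', R.GV (k + 1) s' ∂(M.step k s)

/-- The output `Ṽ_0` of the algorithm. -/
def output : ℝ := (2 * R.P₀ - 1) * R.Vmax 1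

/-- The out-of-boundary accuracy at date `k`: `VOB k` is `ε`-close to `V_k` on `A k`, and the flat
extrapolation of `V_k` is `ε`-close to `V_k` elsewhere outside the hyper-rectangle. -/
def OutOfBoundaryAccuracy (k : ℕ) (hk : 1 ≤ k ∧ k < K) (ε : ℝ) : Prop :=
  ∀ s : M.space, (s : Fin d → ℝ) ∉ (R.D k).toSet →
    (s ∈ R.A k → |R.VOB k s - M.value k s| < ε) ∧
    (s ∉ R.A k → |R.flat k (fun x => M.value k (R.incl hk x)) s - M.value k s| < ε)

end Run

end Bermudan

end

noncomputable section

namespace Bermudan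

/-! ### The Lagrange basis of the Chebyshev nodes -/

/-! The proof combines dynamic programming with two bounds on Chebyshev interpolation: its stability
and its accuracy.

Dynamic programming. The optimal stopping value satisfies the Bellman recursion `dpValue`, both for
the given process and for the chain restarted at date `k` (`stoppingValue_eq`, `value_eq_dpValue`).
The algorithm runs the same recursion with errors. Expectation is nonexpansive in the sup norm and
`max` with a common payoff is 1-Lipschitz, so errors of later dates pass through unamplified. Each
date adds its out-of-boundary error, its interpolation error and the interpolated estimation error
(`abs_GV_sub_dpValue_le`).

Stability. Interpolation amplifies errors at the nodes by at most the `d`-th power of the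
one-variable Lebesgue constant. With `x = cos t` and `N = m + 1`, the Lagrange basis becomes a sum
of two translates of `sin (N a) cot (a / 2)`. The sum of their moduli is periodic in `t` and largest
at `t = 0`; the resulting sum of cotangents telescopes against logarithms of sines (`sum_cot_le`,
`sum_abs_chebLagrange_le`).

Accuracy. In one variable the error is a contour integral on `|w| = r`, `1/ρ < r < 1`, in the
Joukowski coordinate, with integrand `g(J w) K_x(w) T_N(x) / T_N(J w)`. The quotient of Chebyshev
polynomials has size about `2 r^N`, and the mean of `|K_x|` is at most `kernelBound (r^2)`
(`exists_majorant`, `norm_sub_interp_le`). Interpolating one coordinate after another gives `B e (1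
+ λ + ... + λ^(d-1))`, where `e` is the one-variable error factor and `λ` is either the Lebesgue
bound or `1 + e` (`norm_sub_tensor_interp_le`). With `s = √(2 / (1 - r^2))` the target is `B · 2 √d
s^d r^m`. It is reached by finding an admissible `λ ≤ s` when `r^(2N) ≤ 1/4`, and from the trivial
bound `B (1 + Λ^d)`, `Λ` the one-variable Lebesgue bound, otherwise (`abs_sub_chebInterp_le_mul`).
Letting `r` decrease to `1/ρ` gives `epsInt`. -/

/-- The Lagrange basis polynomial of the `j`-th Chebyshev node, as a Chebyshev sum. -/
def chebLagrange (m : ℕ) (j : Fin (m + 1)) (x : ℝ) : ℝ :=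
  ((m : ℝ) + 1)⁻¹ * ∑ l : Fin (m + 1), (if 0 < (l : ℕ) then 2 else 1) *
    (Polynomial.Chebyshev.T ℝ ((l : ℕ) : ℤ)).eval (chebNode m j) *
      (Polynomial.Chebyshev.T ℝ ((l : ℕ) : ℤ)).eval x

namespace Box

variable {d : ℕ} (D : Box d)

theorem theta_affine (x : ℝ) (s : Fin d → ℝ) (i : Fin d)
    (h : s i = (D.U i - D.L i) / 2 * x + (D.U i + D.L i) / 2) : D.theta s i = x := by
  have h' := D.lt i
  have : D.U i - D.L i ≠ 0 := by linarith
  rw [theta, h]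
  field_simp
  ring

theorem theta_node (m : ℕ) (j : Fin d → Fin (m + 1)) (i : Fin d) :
    D.theta (D.node m j) i = chebNode m (j i) :=
  D.theta_affine _ _ _ rfl

theorem abs_theta_le {s : Fin d → ℝ} (hs : s ∈ D.toSet) (i : Fin d) : |D.theta s i| ≤ 1 := by
  have h' := D.lt i
  have h := hs i
  have : 0 < D.U i - D.L i := by linarith
  rw [theta, abs_div, abs_of_pos this, div_le_one this, abs_le]
  constructor <;> linarith

theorem theta_inv (s : Fin d → ℝ) (i : Fin d) :
    (D.U i - D.L i) / 2 * D.theta s i + (D.U i + D.L i) / 2 = s i := by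
  have h' := D.lt i
  have : D.U i - D.L i ≠ 0 := by linarith
  rw [theta]
  field_simp
  ring

/-- The weight `2 ^ #{i | 0 < l i} / (m + 1) ^ d` is a product over the coordinates, so after
exchanging the two sums the sum over `l` factors. -/
theorem chebInterp_eq_sum (m : ℕ) (v : (Fin d → Fin (m + 1)) → ℝ) (s : Fin d → ℝ) :
    D.chebInterp m v s = ∑ j, v j * ∏ i, chebLagrange m (j i) (D.theta s i) := by
  have key : ∀ j : Fin d → Fin (m + 1), ∏ i, chebLagrange m (j i) (D.theta s i) =
      ∑ l : Fin d → Fin (m + 1), ∏ i, (((m : ℝ) + 1)⁻¹ * ((if 0 < (l i : ℕ) then 2 else 1) *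
        (Polynomial.Chebyshev.T ℝ ((l i : ℕ) : ℤ)).eval (chebNode m (j i)) *
        (Polynomial.Chebyshev.T ℝ ((l i : ℕ) : ℤ)).eval (D.theta s i))) := by
    intro j
    simp only [chebLagrange, Finset.mul_sum]
    rw [Finset.prod_univ_sum]
    simp
  simp only [key, Finset.mul_sum, chebInterp, chebCoeff, Finset.sum_mul]
  rw [Finset.sum_comm]
  refine Finset.sum_congr rfl fun j _ => Finset.sum_congr rfl fun l _ => ?_
  simp only [Finset.prod_mul_distrib, chebTensor, theta_node, Finset.prod_ite, Finset.prod_const,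
    Finset.card_univ, Fintype.card_fin, one_pow, mul_one, div_eq_mul_inv, inv_pow]
  ring

end Box

/-! ### The Lagrange basis as translates of a Dirichlet kernel -/

/-- The modified Dirichlet kernel `sin (N a) cot (a / 2)` with `N = m + 1`. -/
def modDirichlet (m : ℕ) (a : ℝ) : ℝ :=
  1 + 2 * ∑ l ∈ Finset.range m, Real.cos (((l : ℝ) + 1) * a) + Real.cos (((m : ℝ) + 1) * a)

theorem modDirichlet_mul_sin (m : ℕ) (a : ℝ) :
    modDirichlet m a * Real.sin (a / 2) = Real.sin (((m : ℝ) + 1) * a) * Real.cos (a / 2) := by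
  induction m with
  | zero =>
    simp only [modDirichlet, Finset.range_zero, Finset.sum_empty, Nat.cast_zero, zero_add, one_mul]
    have h : a = 2 * (a / 2) := by ring
    rw [h, Real.cos_two_mul, Real.sin_two_mul, ← h]
    ring
  | succ m ih =>
    have e1 : ((m : ℝ) + 1) * a = ((m : ℝ) + 3 / 2) * a - a / 2 := by ring
    have e2 : (((m + 1 : ℕ) : ℝ) + 1) * a = ((m : ℝ) + 3 / 2) * a + a / 2 := by push_cast; ring
    simp only [modDirichlet, Finset.sum_range_succ] at ih ⊢
    rw [e2]
    rw [e1] at ih ⊢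
    simp only [Real.sin_add, Real.cos_add, Real.sin_sub, Real.cos_sub] at ih ⊢
    linear_combination ih

theorem modDirichlet_neg (m : ℕ) (a : ℝ) : modDirichlet m (-a) = modDirichlet m a := by
  simp [modDirichlet]

theorem continuous_modDirichlet (m : ℕ) : Continuous (modDirichlet m) := by
  unfold modDirichlet
  fun_prop

theorem modDirichlet_periodic (m : ℕ) : Function.Periodic (modDirichlet m) (2 * Real.pi) := by
  intro a
  have h : ∀ n : ℕ, Real.cos (((n : ℝ) + 1) * (a + 2 * Real.pi)) =
      Real.cos (((n : ℝ) + 1) * a) := by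
    intro n
    have : ((n : ℝ) + 1) * (a + 2 * Real.pi) =
        ((n : ℝ) + 1) * a + ((n + 1 : ℕ) : ℝ) * (2 * Real.pi) := by
      push_cast; ring
    rw [this, Real.cos_add_nat_mul_two_pi]
  simp only [modDirichlet, h]

/-- The angle of the `j`-th Chebyshev node. -/
def chebAngle (m j : ℕ) : ℝ := ((j : ℝ) + 1 / 2) / ((m : ℝ) + 1) * Real.pi

theorem chebNode_eq_cos (m : ℕ) (j : Fin (m + 1)) : chebNode m j = Real.cos (chebAngle m j) := rfl

theorem mul_chebAngle (m j : ℕ) : ((m : ℝ) + 1) * chebAngle m j = j * Real.pi + Real.pi / 2 := by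
  have : (m : ℝ) + 1 ≠ 0 := by positivity
  rw [chebAngle]
  field_simp

theorem chebAngle_pos (m j : ℕ) : 0 < chebAngle m j := by
  have := Real.pi_pos
  unfold chebAngle
  positivity

theorem chebAngle_lt_pi {m j : ℕ} (hj : j < m + 1) : chebAngle m j < Real.pi := by
  have h0 := Real.pi_pos
  have h : (j : ℝ) + 1 ≤ m + 1 := by exact_mod_cast hj
  have : ((j : ℝ) + 1 / 2) / ((m : ℝ) + 1) < 1 := by
    rw [div_lt_one (by positivity)]; linarith
  unfold chebAngle
  nlinarith

theorem cos_mul_chebAngle (m j : ℕ) : Real.cos (((m : ℝ) + 1) * chebAngle m j) = 0 := by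
  rw [mul_chebAngle, Real.cos_add_pi_div_two, Real.sin_nat_mul_pi, neg_zero]

/-- The Lagrange basis has no term of frequency `m + 1`, whereas the kernel has one. In the two
translates these top terms cancel, because `cos ((m + 1) φ) = 0` at a node angle `φ`. -/
theorem chebLagrange_cos (m : ℕ) (j : Fin (m + 1)) (t : ℝ) :
    chebLagrange m j (Real.cos t) = (2 * ((m : ℝ) + 1))⁻¹ *
      (modDirichlet m (t - chebAngle m j) + modDirichlet m (t + chebAngle m j)) := by
  have h0 : Real.cos (((m : ℝ) + 1) * (t - chebAngle m j)) +
      Real.cos (((m : ℝ) + 1) * (t + chebAngle m j)) = 0 := by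
    rw [mul_sub, mul_add, Real.cos_sub, Real.cos_add, cos_mul_chebAngle]
    ring
  have h1 : modDirichlet m (t - chebAngle m j) + modDirichlet m (t + chebAngle m j) =
      2 * (1 + ∑ l ∈ Finset.range m, 2 * Real.cos (((l : ℝ) + 1) * chebAngle m j) *
        Real.cos (((l : ℝ) + 1) * t)) := by
    have : ∀ l : ℕ, 2 * Real.cos (((l : ℝ) + 1) * chebAngle m j) * Real.cos (((l : ℝ) + 1) * t) =
        Real.cos (((l : ℝ) + 1) * (t - chebAngle m j)) +
          Real.cos (((l : ℝ) + 1) * (t + chebAngle m j)) := by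
      intro l
      rw [mul_sub, mul_add, Real.cos_sub, Real.cos_add]
      ring
    simp only [this, Finset.sum_add_distrib, modDirichlet]
    linear_combination h0
  rw [h1, chebLagrange, chebNode_eq_cos, Fin.sum_univ_succ, ← Fin.sum_univ_eq_sum_range
    (fun l => 2 * Real.cos (((l : ℝ) + 1) * chebAngle m j) * Real.cos (((l : ℝ) + 1) * t))]
  simp only [Polynomial.Chebyshev.T_real_cos, Fin.val_succ, Fin.val_zero, lt_irrefl, if_false,
    Nat.succ_pos, if_true]
  push_cast
  simp only [zero_mul, Real.cos_zero, mul_inv]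
  ring

theorem chebAngle_sub (m i j : ℕ) :
    ((m : ℝ) + 1) * (chebAngle m i - chebAngle m j) = ((i : ℤ) - (j : ℤ) : ℤ) * Real.pi := by
  rw [mul_sub, mul_chebAngle, mul_chebAngle]
  push_cast
  ring

theorem chebAngle_add (m i j : ℕ) :
    ((m : ℝ) + 1) * (chebAngle m i + chebAngle m j) = ((i : ℤ) + (j : ℤ) + 1 : ℤ) * Real.pi := by
  rw [mul_add, mul_chebAngle, mul_chebAngle]
  push_cast
  ring

theorem chebAngle_strictMono (m : ℕ) : StrictMono (chebAngle m) := by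
  intro i j h
  have h' : (i : ℝ) < j := by exact_mod_cast h
  have := Real.pi_pos
  unfold chebAngle
  gcongr

theorem modDirichlet_eq_zero {m : ℕ} {a : ℝ} (h : Real.sin (a / 2) ≠ 0)
    (h' : Real.sin (((m : ℝ) + 1) * a) = 0) : modDirichlet m a = 0 := by
  have := modDirichlet_mul_sin m a
  rw [h', zero_mul] at this
  exact (mul_eq_zero.1 this).resolve_right h

theorem modDirichlet_zero (m : ℕ) : modDirichlet m 0 = 2 * ((m : ℝ) + 1) := by
  simp [modDirichlet]
  ring

/-- Differences and sums of node angles are multiples of `π / (m + 1)`. There the kernel vanishes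
unless its argument is a multiple of `2 π`, which happens only for the difference when `i = j`. -/
theorem chebLagrange_node (m : ℕ) (i j : Fin (m + 1)) :
    chebLagrange m j (chebNode m i) = if i = j then 1 else 0 := by
  have hi := chebAngle_lt_pi i.2
  have hj := chebAngle_lt_pi j.2
  have hi0 := chebAngle_pos m i
  have hj0 := chebAngle_pos m j
  have h2 : modDirichlet m (chebAngle m i + chebAngle m j) = 0 := by
    refine modDirichlet_eq_zero ?_ ?_
    · exact (Real.sin_pos_of_pos_of_lt_pi (by linarith) (by linarith)).ne'
    · rw [chebAngle_add, Real.sin_int_mul_pi]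
  rw [chebNode_eq_cos, chebLagrange_cos, h2]
  split_ifs with hij
  · have : (m : ℝ) + 1 ≠ 0 := by positivity
    rw [hij, sub_self, modDirichlet_zero]
    field_simp
    ring
  · have hne : chebAngle m i - chebAngle m j ≠ 0 := by
      intro h0
      exact hij (Fin.ext ((chebAngle_strictMono m).injective (sub_eq_zero.1 h0)))
    have h1 : modDirichlet m (chebAngle m i - chebAngle m j) = 0 := by
      refine modDirichlet_eq_zero ?_ ?_
      · rcases lt_or_gt_of_ne hne with h | h
        · exact (Real.sin_neg_of_neg_of_neg_pi_lt (by linarith) (by linarith)).ne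
        · exact (Real.sin_pos_of_pos_of_lt_pi (by linarith) (by linarith)).ne'
      · rw [chebAngle_sub, Real.sin_int_mul_pi]
    rw [h1]
    ring

/-! ### The Lebesgue constant of the Chebyshev nodes -/

/-- Monotonicity of `sin (n x) / sin x`, without division; the induction expands `sin (n x + x)`. -/
theorem sin_mul_sin_nat_mul_le (n : ℕ) {x y : ℝ} (hx : 0 ≤ x) (hxy : x ≤ y)
    (hy : n * y ≤ Real.pi / 2) (hy' : y ≤ Real.pi / 2) :
    Real.sin x * Real.sin (n * y) ≤ Real.sin (n * x) * Real.sin y := by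
  have hpi := Real.pi_pos
  induction n with
  | zero => simp
  | succ n ih =>
    push_cast at hy ⊢
    have hny : (n : ℝ) * y ≤ Real.pi / 2 := by nlinarith
    have ih := ih hny
    have hn0 : (0 : ℝ) ≤ n * y := mul_nonneg (Nat.cast_nonneg n) (hx.trans hxy)
    have hnx : (n : ℝ) * x ≤ n * y := by gcongr
    have hnx0 : (0 : ℝ) ≤ n * x := by positivity
    have h1 : Real.cos y ≤ Real.cos x := Real.cos_le_cos_of_nonneg_of_le_pi hx (by linarith) hxy
    have h2 : Real.cos (n * y) ≤ Real.cos (n * x) :=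
      Real.cos_le_cos_of_nonneg_of_le_pi hnx0 (by linarith) hnx
    have sx : 0 ≤ Real.sin x := Real.sin_nonneg_of_nonneg_of_le_pi hx (by linarith)
    have sy : 0 ≤ Real.sin y := Real.sin_nonneg_of_nonneg_of_le_pi (by linarith) (by linarith)
    have sny : 0 ≤ Real.sin (n * y) := Real.sin_nonneg_of_nonneg_of_le_pi hn0 (by linarith)
    have cx : 0 ≤ Real.cos x :=
      Real.cos_nonneg_of_neg_pi_div_two_le_of_le (by linarith) (by linarith)
    rw [add_mul, add_mul, one_mul, one_mul, Real.sin_add, Real.sin_add]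
    nlinarith [mul_nonneg (sub_nonneg.2 ih) cx, mul_nonneg (mul_nonneg sx sny) (sub_nonneg.2 h1),
      mul_nonneg (mul_nonneg sx sy) (sub_nonneg.2 h2)]

/-- A midpoint rule for the convex function `cot`, whose primitive is `log sin`. With `u = tan h cot
a` the right side is `log ((1 + u) / (1 - u)) ≥ 2 u`, and `tan h ≥ h`. -/
theorem two_mul_tan_mul_cot_le {a h : ℝ} (h0 : 0 < h) (ha : h < a) (hah : a + h ≤ Real.pi / 2) :
    2 * h * (Real.cos a / Real.sin a) ≤
      Real.log (Real.sin (a + h)) - Real.log (Real.sin (a - h)) := by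
  have hpi := Real.pi_pos
  have sa : 0 < Real.sin a := Real.sin_pos_of_pos_of_lt_pi (by linarith) (by linarith)
  have sm : 0 < Real.sin (a - h) := Real.sin_pos_of_pos_of_lt_pi (by linarith) (by linarith)
  have sp : 0 < Real.sin (a + h) := Real.sin_pos_of_pos_of_lt_pi (by linarith) (by linarith)
  have ca : 0 ≤ Real.cos a := Real.cos_nonneg_of_neg_pi_div_two_le_of_le (by linarith) (by linarith)
  have ch : 0 < Real.cos h := Real.cos_pos_of_mem_Ioo ⟨by linarith, by linarith⟩
  have ht := Real.le_tan h0.le (by linarith)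
  have sh : 0 < Real.sin h := Real.sin_pos_of_pos_of_lt_pi h0 (by linarith)
  have hle : Real.sin (a - h) ≤ Real.sin (a + h) := by
    rw [Real.sin_sub, Real.sin_add]; nlinarith
  have hX : 0 ≤ (Real.sin (a + h) - Real.sin (a - h)) / Real.sin (a - h) :=
    div_nonneg (by linarith) sm.le
  have key := Real.le_log_one_add_of_nonneg hX
  have e1 : 1 + (Real.sin (a + h) - Real.sin (a - h)) / Real.sin (a - h) =
      Real.sin (a + h) / Real.sin (a - h) := by
    field_simp; ring
  rw [e1, Real.log_div sp.ne' sm.ne'] at key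
  refine le_trans ?_ key
  have e2 : 2 * ((Real.sin (a + h) - Real.sin (a - h)) / Real.sin (a - h)) /
      ((Real.sin (a + h) - Real.sin (a - h)) / Real.sin (a - h) + 2) =
      2 * Real.tan h * (Real.cos a / Real.sin a) := by
    have : (Real.sin (a + h) - Real.sin (a - h)) / Real.sin (a - h) + 2 =
        (2 * (Real.sin a * Real.cos h)) / Real.sin (a - h) := by
      rw [div_add' _ _ _ sm.ne', Real.sin_add, Real.sin_sub]; ring
    rw [this, Real.tan_eq_sin_div_cos]
    have : Real.sin (a + h) - Real.sin (a - h) = 2 * (Real.cos a * Real.sin h) := by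
      rw [Real.sin_add, Real.sin_sub]; ring
    rw [this]
    field_simp
  rw [e2]
  gcongr

theorem mul_cot_le {x : ℝ} (hx : 0 < x) (hx1 : x ≤ 1) :
    x * (Real.cos x / Real.sin x) ≤ 1 - x ^ 2 / 3 := by
  have hpi := Real.pi_gt_three
  have sx : 0 < Real.sin x := Real.sin_pos_of_pos_of_lt_pi hx (by linarith)
  have h1 := Real.sin_ge_sub_cube hx.le
  have h2 := Real.cos_bound (x := x) (by rw [abs_of_pos hx]; exact hx1)
  rw [abs_of_pos hx] at h2
  have h3 := (abs_le.1 h2).2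
  rw [← mul_div_assoc, div_le_iff₀ sx]
  have hx2 : x ^ 2 ≤ 1 := by nlinarith
  calc x * Real.cos x ≤ x * (1 - x ^ 2 / 2 + x ^ 4 * (5 / 96)) := by gcongr; linarith
    _ ≤ (1 - x ^ 2 / 3) * (x - x ^ 3 / 6) := by
      have : 0 ≤ x ^ 5 := by positivity
      nlinarith
    _ ≤ _ := by gcongr; nlinarith

theorem log_pi_div_two_ge : 0.45 ≤ Real.log (Real.pi / 2) := by
  have hpi := Real.pi_gt_d2
  rw [Real.le_log_iff_exp_le (by positivity)]
  have h : Real.exp 0.45 ≤ 1.57 := by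
    -- Twentieth powers reduce the claim to `e ^ 9 ≤ 1.57 ^ 20`.
    have h20 : Real.exp 0.45 ^ 20 = Real.exp 1 ^ 9 := by
      rw [← Real.exp_nat_mul, ← Real.exp_nat_mul]; norm_num
    have := Real.exp_one_lt_d9
    refine le_of_pow_le_pow_left₀ (n := 20) (by norm_num) (by norm_num) ?_
    rw [h20]
    calc Real.exp 1 ^ 9 ≤ 2.7182818286 ^ 9 := by gcongr
      _ ≤ _ := by norm_num
  linarith

/-- The first term of the cotangent sum, for `N ≥ 2` nodes and `v = π / (2 N)`. -/
theorem mul_cot_half_le {v : ℝ} (hv : 0 < v) (hv1 : v ≤ Real.pi / 4) :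
    v * (Real.cos (v / 2) / Real.sin (v / 2)) ≤
      Real.pi / 2 + Real.log (Real.pi / 2 / v * Real.sin v) := by
  have hpi := Real.pi_gt_d2
  have hpi' := Real.pi_lt_d2
  have h1 := mul_cot_le (x := v / 2) (by linarith) (by linarith)
  have h2 := Real.sin_ge_sub_cube hv.le
  have hc : v ^ 2 / 6 ≤ 0.104 := by nlinarith
  have hpos : 0 < Real.sin v := Real.sin_pos_of_pos_of_lt_pi hv (by linarith)
  have e : Real.pi / 2 / v * Real.sin v = (Real.pi / 2) * (Real.sin v / v) := by field_simp
  rw [e, Real.log_mul (by positivity) (by positivity)]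
  have h3 := Real.one_sub_inv_le_log_of_pos (x := Real.sin v / v) (by positivity)
  have h4 : 1 - v ^ 2 / 6 ≤ Real.sin v / v := by
    rw [le_div_iff₀ hv]; linarith
  have h5 : (Real.sin v / v)⁻¹ ≤ (1 - v ^ 2 / 6)⁻¹ := by
    apply inv_anti₀ _ h4; linarith
  have h6 : (1 - v ^ 2 / 6)⁻¹ ≤ 1 + v ^ 2 / 6 + 0.0125 := by
    rw [inv_le_iff_one_le_mul₀ (by linarith)]
    nlinarith [sq_nonneg v]
  have := log_pi_div_two_ge
  nlinarith

/-- The half-angles `(j + 1/2) v`, `v = π / (2 (m + 1))`, are midpoints of intervals of length `v`.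
For `j ≥ 1` the midpoint rule telescopes to `log sin (π/2) - log sin v`. On the first interval `log
sin` is singular, so that term is estimated directly; its bound contains `log sin v`, which cancels.
-/
theorem sum_cot_le (m : ℕ) :
    ∑ j ∈ Finset.range (m + 1), Real.cos (chebAngle m j / 2) / Real.sin (chebAngle m j / 2) ≤
      ((m : ℝ) + 1) * (2 / Real.pi * Real.log ((m : ℝ) + 1) + 1) := by
  have hpi := Real.pi_pos
  have hN : (0 : ℝ) < (m : ℝ) + 1 := by positivity
  set v : ℝ := Real.pi / (2 * ((m : ℝ) + 1)) with hv
  have hv0 : 0 < v := by positivity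
  have hNv : ((m : ℝ) + 1) * v = Real.pi / 2 := by rw [hv]; field_simp
  have htail : ∑ j ∈ Finset.range m,
      v * (Real.cos (chebAngle m (j + 1) / 2) / Real.sin (chebAngle m (j + 1) / 2)) ≤
      - Real.log (Real.sin v) := by
    calc _ ≤ ∑ j ∈ Finset.range m, (Real.log (Real.sin (((j + 1 : ℕ) + 1 : ℝ) * v)) -
          Real.log (Real.sin (((j : ℝ) + 1) * v))) := by
          refine Finset.sum_le_sum fun j hj => ?_
          have hj' : (j : ℝ) + 1 ≤ m := by exact_mod_cast Finset.mem_range.1 hj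
          have ha : chebAngle m (j + 1) / 2 = ((j : ℝ) + 3 / 2) * v := by
            rw [chebAngle, hv]; push_cast; field_simp; ring
          have := two_mul_tan_mul_cot_le (a := chebAngle m (j + 1) / 2) (h := v / 2) (by linarith)
            (by rw [ha]; nlinarith [(Nat.cast_nonneg j : (0:ℝ) ≤ j)])
            (by rw [ha, ← hNv]; nlinarith)
          have e1 : chebAngle m (j + 1) / 2 + v / 2 = ((j + 1 : ℕ) + 1 : ℝ) * v := by
            rw [ha]; push_cast; ring
          have e2 : chebAngle m (j + 1) / 2 - v / 2 = ((j : ℝ) + 1) * v := by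
            rw [ha]; ring
          rwa [e1, e2, mul_div_cancel₀ v two_ne_zero] at this
      _ = _ := by
          rw [Finset.sum_range_sub (fun j : ℕ => Real.log (Real.sin (((j : ℝ) + 1) * v))), hNv]
          simp
  have hhead : v * (Real.cos (chebAngle m 0 / 2) / Real.sin (chebAngle m 0 / 2)) ≤
      Real.pi / 2 + Real.log (((m : ℝ) + 1) * Real.sin v) := by
    have ha : chebAngle m 0 / 2 = v / 2 := by
      rw [chebAngle, hv]; push_cast; field_simp; ring
    rw [ha]
    -- With a single node `v = π/2` lies outside the range of `mul_cot_half_le`, and equality holds.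
    rcases Nat.eq_zero_or_pos m with rfl | hm
    · have : v = Real.pi / 2 := by rw [hv]; simp
      rw [this, show Real.pi / 2 / 2 = Real.pi / 4 by ring]
      simp
    · have hm' : (1 : ℝ) ≤ m := by exact_mod_cast hm
      have hv4 : v ≤ Real.pi / 4 := by
        rw [hv]; gcongr; linarith
      have := mul_cot_half_le hv0 hv4
      rwa [show Real.pi / 2 / v = (m : ℝ) + 1 by rw [← hNv]; field_simp] at this
  have sv : 0 < Real.sin v := Real.sin_pos_of_pos_of_lt_pi hv0 (by nlinarith)
  rw [Real.log_mul hN.ne' sv.ne'] at hhead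
  rw [← Finset.mul_sum] at htail
  rw [Finset.sum_range_succ', ]
  have e : ((m : ℝ) + 1) * (2 / Real.pi * Real.log ((m : ℝ) + 1) + 1) =
      v⁻¹ * (Real.log ((m : ℝ) + 1) + Real.pi / 2) := by
    rw [hv]; field_simp
  rw [e, inv_mul_eq_div, le_div_iff₀ hv0]
  linarith

/-- Here both moduli are `cos (N t) cot ((φ ± t) / 2)`, with sum `cos (N t) sin φ / (sin² (φ/2) -
sin² (t/2))`. Comparison with the value `2 cot (φ/2)` at `t = 0` reduces to `sin² (t/2) ≤ sin² (φ/2)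
(1 - cos (N t))`. The worst `φ` is the first node angle `π / (2 N)`, and there the monotonicity of
`sin (N x) / sin x` applies. -/
theorem abs_modDirichlet_pair_le (m j : ℕ) (hj : j < m + 1) {t : ℝ} (ht : |t| < chebAngle m 0) :
    |modDirichlet m (t - chebAngle m j)| + |modDirichlet m (t + chebAngle m j)| ≤
      2 * (Real.cos (chebAngle m j / 2) / Real.sin (chebAngle m j / 2)) := by
  have hpi := Real.pi_pos
  have hN : (0 : ℝ) < (m : ℝ) + 1 := by positivity
  set φ := chebAngle m j with hφ
  have hφ0 : chebAngle m 0 ≤ φ := (chebAngle_strictMono m).monotone (Nat.zero_le j)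
  have hφ1 : φ + chebAngle m 0 ≤ Real.pi := by
    have h1 : φ ≤ chebAngle m m := (chebAngle_strictMono m).monotone (by omega)
    have h2 : chebAngle m m + chebAngle m 0 = Real.pi := by
      unfold chebAngle; push_cast; field_simp; ring
    linarith
  have hN0 := mul_chebAngle m 0
  rw [Nat.cast_zero, zero_mul, zero_add] at hN0
  have ht' := abs_lt.1 ht
  have hcosN : 0 ≤ Real.cos (((m : ℝ) + 1) * t) := by
    apply Real.cos_nonneg_of_neg_pi_div_two_le_of_le <;> nlinarith
  have habs : ∀ u : ℝ, |u| < chebAngle m 0 → |modDirichlet m (φ - u)| * Real.sin ((φ - u) / 2) =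
      |Real.cos (((m : ℝ) + 1) * u)| * Real.cos ((φ - u) / 2) := by
    intro u hu
    have hu' := abs_lt.1 hu
    have h := congrArg abs (modDirichlet_mul_sin m (φ - u))
    rw [abs_mul, abs_mul, abs_of_nonneg (a := Real.sin _), abs_of_nonneg (a := Real.cos _)] at h
    · rw [h, mul_sub, mul_chebAngle, Real.sin_sub, Real.sin_add_pi_div_two, Real.cos_add_pi_div_two,
        Real.sin_nat_mul_pi, neg_zero, zero_mul, sub_zero, abs_mul, Real.cos_nat_mul_pi, abs_pow,
        abs_neg, abs_one,
        one_pow, one_mul]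
    · apply Real.cos_nonneg_of_neg_pi_div_two_le_of_le <;> linarith
    · apply Real.sin_nonneg_of_nonneg_of_le_pi <;> linarith
  have e1 : modDirichlet m (t - φ) = modDirichlet m (φ - t) := by
    rw [← modDirichlet_neg, neg_sub]
  have h1 := habs t ht
  have h2 := habs (-t) (by rwa [abs_neg])
  rw [mul_neg, Real.cos_neg, abs_of_nonneg hcosN, sub_neg_eq_add] at h2
  rw [abs_of_nonneg hcosN] at h1
  have sm : 0 < Real.sin ((φ - t) / 2) := Real.sin_pos_of_pos_of_lt_pi (by linarith) (by linarith)
  have sp : 0 < Real.sin ((φ + t) / 2) := Real.sin_pos_of_pos_of_lt_pi (by linarith) (by linarith)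
  have s0 : 0 < Real.sin (φ / 2) :=
    Real.sin_pos_of_pos_of_lt_pi (by linarith [chebAngle_pos m 0])
      (by linarith [chebAngle_pos m 0])
  have c0 : 0 ≤ Real.cos (φ / 2) := by
    apply Real.cos_nonneg_of_neg_pi_div_two_le_of_le <;> linarith [chebAngle_pos m 0]
  rw [e1, add_comm t φ, eq_div_of_mul_eq sm.ne' h1, eq_div_of_mul_eq sp.ne' h2]
  have hsin : Real.sin (t / 2) ^ 2 ≤ Real.sin (φ / 2) ^ 2 * (1 - Real.cos (((m : ℝ) + 1) * t)) := by
    have hx := sin_mul_sin_nat_mul_le (m + 1) (x := |t| / 2) (y := chebAngle m 0 / 2)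
      (by positivity)
      (by linarith) (by push_cast; linarith) (by linarith)
    push_cast at hx
    have ee : ((m : ℝ) + 1) * (chebAngle m 0 / 2) = Real.pi / 4 := by linarith
    rw [ee, Real.sin_pi_div_four] at hx
    have hx0 : 0 ≤ Real.sin (|t| / 2) :=
      Real.sin_nonneg_of_nonneg_of_le_pi (by positivity) (by linarith)
    have hsq := mul_self_le_mul_self (by positivity) hx
    have h2 : √2 * √2 = (2 : ℝ) := Real.mul_self_sqrt (by norm_num)
    have hsqt : Real.sin (|t| / 2) ^ 2 = Real.sin (t / 2) ^ 2 := by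
      rcases abs_choice t with h | h <;> rw [h]
      rw [neg_div, Real.sin_neg, neg_sq]
    have hsqN : Real.sin (((m : ℝ) + 1) * (|t| / 2)) ^ 2 =
        (1 - Real.cos (((m : ℝ) + 1) * t)) / 2 := by
      have : ((m : ℝ) + 1) * t = 2 * (((m : ℝ) + 1) * (t / 2)) := by ring
      rw [this, Real.cos_two_mul, Real.cos_sq']
      rcases abs_choice t with h | h <;> rw [h]
      · ring
      · rw [neg_div, mul_neg, Real.sin_neg]; ring
    have hle : Real.sin (chebAngle m 0 / 2) ≤ Real.sin (φ / 2) :=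
      Real.sin_le_sin_of_le_of_le_pi_div_two (by linarith [chebAngle_pos m 0])
        (by linarith [chebAngle_pos m 0]) (by linarith)
    have hge : 0 ≤ Real.sin (chebAngle m 0 / 2) :=
      Real.sin_nonneg_of_nonneg_of_le_pi (by linarith [chebAngle_pos m 0]) (by linarith)
    have hle2 : Real.sin (chebAngle m 0 / 2) ^ 2 ≤ Real.sin (φ / 2) ^ 2 := by gcongr
    have hc1 : 0 ≤ 1 - Real.cos (((m : ℝ) + 1) * t) := by
      linarith [Real.cos_le_one (((m : ℝ) + 1) * t)]
    rw [← hsqt]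
    have : Real.sin (|t| / 2) * (√2 / 2) * (Real.sin (|t| / 2) * (√2 / 2)) =
        Real.sin (|t| / 2) ^ 2 / 2 := by
      linear_combination (Real.sin (|t| / 2) ^ 2 / 4) * h2
    rw [this] at hsq
    have : Real.sin (((m : ℝ) + 1) * (|t| / 2)) * Real.sin (chebAngle m 0 / 2) *
        (Real.sin (((m : ℝ) + 1) * (|t| / 2)) * Real.sin (chebAngle m 0 / 2)) =
        (1 - Real.cos (((m : ℝ) + 1) * t)) / 2 * Real.sin (chebAngle m 0 / 2) ^ 2 := by
      rw [← hsqN]; ring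
    rw [this] at hsq
    nlinarith
  have hprod : Real.sin ((φ - t) / 2) * Real.sin ((φ + t) / 2) =
      Real.sin (φ / 2) ^ 2 - Real.sin (t / 2) ^ 2 := by
    rw [sub_div, add_div, Real.sin_sub, Real.sin_add]
    nlinarith [Real.sin_sq_add_cos_sq (φ / 2), Real.sin_sq_add_cos_sq (t / 2)]
  have hnum : Real.cos ((φ - t) / 2) * Real.sin ((φ + t) / 2) +
      Real.sin ((φ - t) / 2) * Real.cos ((φ + t) / 2) =
        2 * Real.sin (φ / 2) * Real.cos (φ / 2) := by
    rw [← Real.sin_two_mul, show 2 * (φ / 2) = (φ + t) / 2 + (φ - t) / 2 by ring, Real.sin_add]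
    ring
  have hpos : 0 < Real.sin (φ / 2) ^ 2 - Real.sin (t / 2) ^ 2 := hprod ▸ mul_pos sm sp
  have e3 : Real.cos (((m : ℝ) + 1) * t) * Real.cos ((φ - t) / 2) / Real.sin ((φ - t) / 2) +
      Real.cos (((m : ℝ) + 1) * t) * Real.cos ((φ + t) / 2) / Real.sin ((φ + t) / 2) =
      Real.cos (((m : ℝ) + 1) * t) * (2 * Real.sin (φ / 2) * Real.cos (φ / 2)) /
        (Real.sin (φ / 2) ^ 2 - Real.sin (t / 2) ^ 2) := by
    rw [← hnum, ← hprod]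
    field_simp
  have e4 : 2 * (Real.cos (φ / 2) / Real.sin (φ / 2)) *
      (Real.sin (φ / 2) ^ 2 - Real.sin (t / 2) ^ 2) =
      2 * Real.cos (φ / 2) * (Real.sin (φ / 2) ^ 2 - Real.sin (t / 2) ^ 2) / Real.sin (φ / 2) := by
    ring
  rw [e3, div_le_iff₀ hpos, e4, le_div_iff₀ s0]
  nlinarith [mul_le_mul_of_nonneg_left hsin c0]

/-- The sum of the absolute values of the Dirichlet kernels centred at the nodes and at their
reflections. -/
def dirichletSum (m : ℕ) (t : ℝ) : ℝ :=
  ∑ j ∈ Finset.range (m + 1),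
    (|modDirichlet m (t - chebAngle m j)| + |modDirichlet m (t + chebAngle m j)|)

/-- The shift `π / (m + 1)` permutes the angles `±φ_j` cyclically modulo `2 π`. -/
theorem dirichletSum_periodic (m : ℕ) :
    Function.Periodic (dirichletSum m) (2 * chebAngle m 0) := by
  intro t
  have hs : ∀ j : ℕ, chebAngle m (j + 1) = chebAngle m j + 2 * chebAngle m 0 := by
    intro j; unfold chebAngle; push_cast; ring
  have hper : modDirichlet m (t + chebAngle m (m + 1)) = modDirichlet m (t - chebAngle m m) := by
    rw [← modDirichlet_periodic m (t - chebAngle m m)]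
    congr 1
    unfold chebAngle; push_cast; field_simp; ring
  unfold dirichletSum
  rw [Finset.sum_add_distrib, Finset.sum_add_distrib, Finset.sum_range_succ',
    Finset.sum_range_succ (fun j => |modDirichlet m (t - chebAngle m j)|)]
  have e1 : ∀ j : ℕ, t + 2 * chebAngle m 0 - chebAngle m (j + 1) = t - chebAngle m j := by
    intro j; rw [hs]; ring
  have e2 : ∀ j : ℕ, t + 2 * chebAngle m 0 + chebAngle m j = t + chebAngle m (j + 1) := by
    intro j; rw [hs]; ring
  simp only [e1, e2]
  rw [Finset.sum_range_succ (fun j => |modDirichlet m (t + chebAngle m (j + 1))|), hper,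
    Finset.sum_range_succ' (fun j => |modDirichlet m (t + chebAngle m j)|)]
  rw [show t + 2 * chebAngle m 0 - chebAngle m 0 = t + chebAngle m 0 by ring]
  ring

theorem dirichletSum_le (m : ℕ) (t : ℝ) :
    dirichletSum m t ≤ 2 * ((m : ℝ) + 1) * (2 / Real.pi * Real.log ((m : ℝ) + 1) + 1) := by
  have h0 := chebAngle_pos m 0
  have hI : ∀ u ∈ Set.Ioo (-chebAngle m 0) (chebAngle m 0), dirichletSum m u ≤
      2 * ((m : ℝ) + 1) * (2 / Real.pi * Real.log ((m : ℝ) + 1) + 1) := by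
    intro u hu
    calc dirichletSum m u ≤ ∑ j ∈ Finset.range (m + 1),
          2 * (Real.cos (chebAngle m j / 2) / Real.sin (chebAngle m j / 2)) :=
          Finset.sum_le_sum fun j hj =>
            abs_modDirichlet_pair_le m j (Finset.mem_range.1 hj) (abs_lt.2 hu)
      _ ≤ _ := by
          rw [← Finset.mul_sum]
          nlinarith [sum_cot_le m]
  obtain ⟨u, hu, he⟩ := (dirichletSum_periodic m).exists_mem_Ico (by positivity) t (-chebAngle m 0)
  rw [he]
  have hcont : Continuous (dirichletSum m) := by
    have := continuous_modDirichlet m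
    unfold dirichletSum
    fun_prop
  -- The pair bound needs the open interval, while the period window contains its left endpoint;
  -- continuity covers it.
  refine le_on_closure hI hcont.continuousOn continuousOn_const ?_
  rw [closure_Ioo (by linarith)]
  exact ⟨hu.1, by linarith [hu.2]⟩

theorem sum_abs_chebLagrange_le (m : ℕ) {x : ℝ} (hx : |x| ≤ 1) :
    ∑ j, |chebLagrange m j x| ≤ 2 / Real.pi * Real.log ((m : ℝ) + 1) + 1 := by
  have hx' := abs_le.1 hx
  have hN : (0 : ℝ) < 2 * ((m : ℝ) + 1) := by positivity
  rw [← Real.cos_arccos hx'.1 hx'.2]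
  calc _ ≤ ∑ j : Fin (m + 1), (2 * ((m : ℝ) + 1))⁻¹ *
        (|modDirichlet m (Real.arccos x - chebAngle m j)| +
          |modDirichlet m (Real.arccos x + chebAngle m j)|) := by
        refine Finset.sum_le_sum fun j _ => ?_
        rw [chebLagrange_cos, abs_mul, abs_of_pos (inv_pos.2 hN)]
        gcongr
        exact abs_add_le _ _
    _ = (2 * ((m : ℝ) + 1))⁻¹ * dirichletSum m (Real.arccos x) := by
        rw [← Finset.mul_sum, dirichletSum, ← Fin.sum_univ_eq_sum_range
          (fun j => |modDirichlet m (Real.arccos x - chebAngle m j)| +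
            |modDirichlet m (Real.arccos x + chebAngle m j)|)]
    _ ≤ _ := by
        rw [inv_mul_le_iff₀ hN]
        exact dirichletSum_le m _

theorem Box.abs_chebInterp_le {d : ℕ} (D : Box d) (m : ℕ) (v : (Fin d → Fin (m + 1)) → ℝ) {ε : ℝ}
    (hv : ∀ j, |v j| ≤ ε) {s : Fin d → ℝ} (hs : s ∈ D.toSet) :
    |D.chebInterp m v s| ≤ lebesgueFactor d m * ε := by
  have hε : 0 ≤ ε := (abs_nonneg _).trans (hv fun _ => 0)
  rw [D.chebInterp_eq_sum]
  calc _ ≤ ∑ j : Fin d → Fin (m + 1), |v j * ∏ i, chebLagrange m (j i) (D.theta s i)| :=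
        Finset.abs_sum_le_sum_abs _ _
    _ ≤ ∑ j : Fin d → Fin (m + 1), ε * ∏ i, |chebLagrange m (j i) (D.theta s i)| := by
        refine Finset.sum_le_sum fun j _ => ?_
        rw [abs_mul, Finset.abs_prod]
        gcongr
        exact hv j
    _ = ε * ∏ i : Fin d, ∑ j, |chebLagrange m j (D.theta s i)| := by
        rw [← Finset.mul_sum, Finset.prod_univ_sum]
        simp
    _ ≤ ε * ∏ _i : Fin d, (2 / Real.pi * Real.log ((m : ℝ) + 1) + 1) := by
        refine mul_le_mul_of_nonneg_left (Finset.prod_le_prod (fun i _ => ?_) fun i _ => ?_) hε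
        · exact Finset.sum_nonneg fun j _ => abs_nonneg _
        · exact sum_abs_chebLagrange_le m (D.abs_theta_le hs i)
    _ = _ := by
        rw [Finset.prod_const, Finset.card_univ, Fintype.card_fin, lebesgueFactor, mul_comm]

/-! ### Polynomial reproduction -/

theorem chebNode_injective (m : ℕ) : Function.Injective (chebNode m) := by
  intro i j h
  have h1 := chebLagrange_node m i j
  rw [h, chebLagrange_node m j j, if_pos rfl] at h1
  by_contra hij
  rw [if_neg hij] at h1
  exact one_ne_zero h1

theorem abs_chebNode_le (m : ℕ) (j : Fin (m + 1)) : |chebNode m j| ≤ 1 :=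
  Real.abs_cos_le_one _

theorem eval_T_chebNode (m : ℕ) (j : Fin (m + 1)) :
    (Polynomial.Chebyshev.T ℝ ((m : ℤ) + 1)).eval (chebNode m j) = 0 := by
  rw [chebNode_eq_cos, Polynomial.Chebyshev.T_real_cos]
  push_cast
  exact cos_mul_chebAngle m j

/-- The Lagrange basis polynomial as a complex polynomial. -/
def chebLagrangePoly (m : ℕ) (j : Fin (m + 1)) : Polynomial ℂ :=
  ∑ l : Fin (m + 1), Polynomial.C ((((m : ℝ) + 1)⁻¹ * ((if 0 < (l : ℕ) then 2 else 1) *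
    (Polynomial.Chebyshev.T ℝ ((l : ℕ) : ℤ)).eval (chebNode m j)) : ℝ) : ℂ) *
      Polynomial.Chebyshev.T ℂ ((l : ℕ) : ℤ)

theorem eval_chebLagrangePoly (m : ℕ) (j : Fin (m + 1)) (x : ℝ) :
    (chebLagrangePoly m j).eval (x : ℂ) = (chebLagrange m j x : ℂ) := by
  simp only [chebLagrangePoly, Polynomial.eval_finsetSum, Polynomial.eval_mul, Polynomial.eval_C,
    ← Polynomial.Chebyshev.complex_ofReal_eval_T, ← Complex.ofReal_mul, ← Complex.ofReal_sum,
    chebLagrange, Finset.mul_sum]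
  congr 1
  refine Finset.sum_congr rfl fun l _ => ?_
  ring

theorem degree_C_mul_le {R : Type*} [Semiring R] (a : R) (p : Polynomial R) :
    (Polynomial.C a * p).degree ≤ p.degree := by
  rw [← Polynomial.smul_eq_C_mul]
  exact Polynomial.degree_smul_le a p

theorem degree_chebLagrangePoly_lt (m : ℕ) (j : Fin (m + 1)) :
    (chebLagrangePoly m j).degree < (m + 1 : ℕ) := by
  refine (Polynomial.degree_sum_le _ _).trans_lt ?_
  rw [Finset.sup_lt_iff (WithBot.bot_lt_coe _)]
  intro l _
  refine (degree_C_mul_le _ _).trans_lt ?_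
  rw [Polynomial.Chebyshev.degree_T]
  exact_mod_cast l.2

/-- Both sides are polynomials of degree at most `m` that agree at `m + 1` distinct nodes. Complex
coefficients are needed because this is applied to quotients depending on a complex `z`. -/
theorem sum_chebLagrange_mul_eval (m : ℕ) (p : Polynomial ℂ) (hp : p.degree < (m + 1 : ℕ))
    (x : ℝ) : ∑ j, (chebLagrange m j x : ℂ) * p.eval (chebNode m j : ℂ) = p.eval (x : ℂ) := by
  have h : (∑ j, chebLagrangePoly m j * Polynomial.C (p.eval (chebNode m j : ℂ))) = p := by
    refine Polynomial.eq_of_degrees_lt_of_eval_index_eq (Finset.univ : Finset (Fin (m + 1)))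
      (v := fun i => (chebNode m i : ℂ)) ?_ ?_ ?_ ?_
    · intro i _ j _ hij
      exact chebNode_injective m (Complex.ofReal_injective hij)
    · rw [Finset.card_univ, Fintype.card_fin]
      refine (Polynomial.degree_sum_le _ _).trans_lt ?_
      rw [Finset.sup_lt_iff (WithBot.bot_lt_coe _)]
      intro j _
      rw [mul_comm]
      exact (degree_C_mul_le _ _).trans_lt (degree_chebLagrangePoly_lt m j)
    · rwa [Finset.card_univ, Fintype.card_fin]
    · intro i _
      simp [Polynomial.eval_finsetSum, eval_chebLagrangePoly, chebLagrange_node,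
        apply_ite Complex.ofReal]
  conv_rhs => rw [← h]
  simp [Polynomial.eval_finsetSum, eval_chebLagrangePoly]

/-- The interpolant of `y ↦ 1 / (z - y)` is `W(y) / T(z)` with `W(y) = (T(y) - T(z)) / (y - z)`:
this is a polynomial of degree at most `m` in `y`, and `T` vanishes at the nodes. -/
theorem sum_chebLagrange_mul_inv (m : ℕ) (x : ℝ) (z : ℂ) (hx : z ≠ x)
    (hz : (Polynomial.Chebyshev.T ℂ ((m : ℤ) + 1)).eval z ≠ 0) :
    ∑ j, (chebLagrange m j x : ℂ) * (z - chebNode m j)⁻¹ =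
      (z - x)⁻¹ * (1 - (Polynomial.Chebyshev.T ℂ ((m : ℤ) + 1)).eval (x : ℂ) /
        (Polynomial.Chebyshev.T ℂ ((m : ℤ) + 1)).eval z) := by
  set T := Polynomial.Chebyshev.T ℂ ((m : ℤ) + 1) with hT
  obtain ⟨W, hW⟩ := Polynomial.X_sub_C_dvd_sub_C_eval (a := z) (p := T)
  have hev : ∀ y : ℂ, T.eval y - T.eval z = (y - z) * W.eval y := by
    intro y
    have := congrArg (Polynomial.eval y) hW
    simpa using this
  have hdT : T.degree = ((m + 1 : ℕ) : WithBot ℕ) := by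
    rw [hT, Polynomial.Chebyshev.degree_T]
    congr 1
  have hW0 : W ≠ 0 := by
    rintro rfl
    rw [mul_zero, sub_eq_zero] at hW
    have : T.degree ≤ 0 := by rw [hW]; exact Polynomial.degree_C_le
    rw [hdT] at this
    have : m + 1 ≤ 0 := by exact_mod_cast this
    omega
  have hdW : W.degree < ((m + 1 : ℕ) : WithBot ℕ) := by
    have h1 : (T - Polynomial.C (T.eval z)).natDegree = m + 1 := by
      rw [Polynomial.natDegree_sub_C, Polynomial.natDegree_eq_of_degree_eq_some hdT]
    rw [hW, Polynomial.natDegree_mul (Polynomial.X_sub_C_ne_zero z) hW0,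
      Polynomial.natDegree_X_sub_C] at h1
    rw [← Polynomial.natDegree_lt_iff_degree_lt hW0]
    omega
  have hrep := sum_chebLagrange_mul_eval m W hdW x
  have hnode : ∀ j, (z - chebNode m j)⁻¹ = W.eval (chebNode m j : ℂ) / T.eval z := by
    intro j
    have h0 : T.eval (chebNode m j : ℂ) = 0 := by
      have := Polynomial.Chebyshev.complex_ofReal_eval_T (chebNode m j) ((m : ℤ) + 1)
      rw [eval_T_chebNode] at this
      rw [hT, ← this, Complex.ofReal_zero]
    have h := hev (chebNode m j)
    rw [h0, zero_sub] at h
    have hne : z - chebNode m j ≠ 0 := by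
      intro h'
      rw [← neg_sub, h', neg_zero, zero_mul, neg_eq_zero] at h
      exact hz h
    rw [eq_div_iff hz, inv_mul_eq_iff_eq_mul₀ hne]
    linear_combination -h
  have hxz : z - x ≠ 0 := sub_ne_zero.2 hx
  simp only [hnode, mul_div_assoc']
  rw [← Finset.sum_div, hrep, div_eq_iff hz, ← mul_right_inj' hxz]
  field_simp
  linear_combination hev x

/-! ### The mean modulus of `(1 + w) / (1 - w)` on a circle -/

/-- On `|w|² = q` the conjugate of `w` is `q / w`, so a squared modulus is rational in `w`. Its
partial fractions combine into the real part of a function without poles in the disc when `0 < β <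
1`, so its circle mean is the value at `0`. `normSq_one_sub_div` treats the other factor likewise.
-/
theorem normSq_one_add_div (β q : ℝ) (w : ℂ) (hw : Complex.normSq w = q)
    (h1 : 1 - (β : ℂ) * w ^ 2 ≠ 0) (h2 : 1 - β * q ≠ 0) (h3 : 1 - β ^ 2 * q ^ 2 ≠ 0) :
    Complex.normSq ((1 + w) / (1 - β * w ^ 2)) =
      (((1 + q) / (1 - β ^ 2 * q ^ 2) * ((1 + β * w ^ 2) / (1 - β * w ^ 2)) +
        2 * w / ((1 - β * q) * (1 - β * w ^ 2)) : ℂ)).re := by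
  apply Complex.ofReal_injective
  rw [← Complex.mul_conj]
  rw [Complex.re_eq_add_conj]
  simp only [map_div₀, map_add, map_sub, map_mul, map_one, map_pow, Complex.conj_ofReal, map_ofNat]
  have h1' : 1 - (β : ℂ) * (starRingEnd ℂ) w ^ 2 ≠ 0 := by
    intro h
    apply h1
    have := congrArg (starRingEnd ℂ) h
    simpa using this
  have hq : (q : ℂ) = w * (starRingEnd ℂ) w := by rw [Complex.mul_conj, hw]
  have h2' : 1 - (β : ℂ) * q ≠ 0 := by exact_mod_cast h2
  have h3' : 1 - (β : ℂ) ^ 2 * q ^ 2 ≠ 0 := by exact_mod_cast h3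
  generalize (starRingEnd ℂ) w = v at *
  have h1c : 1 - w ^ 2 * (β : ℂ) ≠ 0 := by rwa [mul_comm]
  field_simp
  rw [hq]
  ring

theorem normSq_one_sub_div (β q : ℝ) (w : ℂ) (hw : Complex.normSq w = q)
    (h1 : 1 - w ≠ 0) (h2 : 1 - q ≠ 0) :
    Complex.normSq ((1 - β * w ^ 2) / (1 - w)) =
      ((1 + q + (1 - β) ^ 2 * q ^ 2 / (1 - q) +
        2 * (1 + q * (1 - β) + (1 - β) ^ 2 * q ^ 2 / (1 - q)) * w +
        2 * ((1 - β) * (1 + q) + (1 - β) ^ 2 * q ^ 2 / (1 - q)) * (w ^ 2 / (1 - w)) : ℂ)).re := by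
  apply Complex.ofReal_injective
  rw [← Complex.mul_conj]
  rw [Complex.re_eq_add_conj]
  simp only [map_div₀, map_add, map_sub, map_mul, map_one, map_pow, Complex.conj_ofReal, map_ofNat]
  have h1' : 1 - (starRingEnd ℂ) w ≠ 0 := by
    intro h
    apply h1
    have := congrArg (starRingEnd ℂ) h
    simpa using this
  have hq : (q : ℂ) = w * (starRingEnd ℂ) w := by rw [Complex.mul_conj, hw]
  have h2' : 1 - (q : ℂ) ≠ 0 := by exact_mod_cast h2
  generalize (starRingEnd ℂ) w = v at *
  field_simp
  rw [hq]
  ring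

/-- The bound `(1 + q) (1 - q ^ 2) ^ (-1/4)` for the mean of `|1 + w| / |1 - w|` on the circle
`|w| ^ 2 = q`. -/
def kernelBound (q : ℝ) : ℝ := (1 + q) / √(√(1 - q ^ 2))

/-- Inserting `1 - β w²` splits the modulus into a product `X Y` of two factors whose squares are
real parts of analytic functions on the circle. The inequality `X Y ≤ η X² / 2 + Y² / (2 η)` then
bounds the modulus by the real part of an analytic `Ψ`, and the mean of `Ψ` is `Ψ 0`. This is
Cauchy–Schwarz for circle means. -/
theorem exists_majorant {r : ℝ} (h0 : 0 < r) (h1 : r < 1) :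
    ∃ Ψ : ℂ → ℂ, DifferentiableOn ℂ Ψ (Metric.ball 0 1) ∧ Ψ 0 = kernelBound (r ^ 2) ∧
      ∀ w : ℂ, ‖w‖ = r → ‖(1 + w) / (1 - w)‖ ≤ (Ψ w).re := by
  set q : ℝ := r ^ 2 with hq
  have hq0 : 0 < q := by positivity
  have hq1 : q < 1 := by rw [hq]; nlinarith
  set k : ℝ := √(1 - q ^ 2) with hk
  have hk2 : k ^ 2 = 1 - q ^ 2 := Real.sq_sqrt (by nlinarith)
  have hk0 : 0 < k := Real.sqrt_pos.2 (by nlinarith)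
  have hk1 : k < 1 := by nlinarith
  -- The root in `(0, 1)` of `q² β² - 2 β + 1 = 0`, the stationarity condition in `β` for the
  -- product `L1 * L2` of the two means.
  set β : ℝ := 1 / (1 + k) with hβ
  have hβ0 : 0 < β := by positivity
  have hβ1 : β < 1 := by rw [hβ, div_lt_one (by positivity)]; linarith
  have hC0 : 0 < kernelBound q := by
    have := Real.sqrt_pos.2 hk0
    rw [kernelBound]; positivity
  have hC2 : kernelBound q ^ 2 = (1 + q) ^ 2 / k := by
    rw [kernelBound, div_pow, Real.sq_sqrt hk0.le]
  have hβq : β ^ 2 * q ^ 2 < 1 := by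
    have : β * q < 1 := by nlinarith
    nlinarith [mul_pos hβ0 hq0]
  set L1 : ℝ := (1 + q) / (1 - β ^ 2 * q ^ 2) with hL1
  set L2 : ℝ := 1 + q + (1 - β) ^ 2 * q ^ 2 / (1 - q) with hL2
  have hL10 : 0 < L1 := div_pos (by linarith) (by linarith)
  have hL12 : L1 * L2 = kernelBound q ^ 2 := by
    have e1 : 1 - β ^ 2 * q ^ 2 = 2 * k / (1 + k) := by
      have : q ^ 2 = 1 - k ^ 2 := by linarith
      rw [this, hβ]; field_simp; ring
    have e2 : (1 - β) ^ 2 * q ^ 2 / (1 - q) = (1 - k) * (1 + q) / (1 + k) := by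
      have hq1' : 1 - q ≠ 0 := by linarith
      have : k ^ 2 = (1 - q) * (1 + q) := by rw [hk2]; ring
      have e3 : (1 - β) ^ 2 * q ^ 2 = k ^ 2 * (1 - k) / (1 + k) := by
        have : q ^ 2 = 1 - k ^ 2 := by linarith
        rw [this, hβ]; field_simp; ring
      rw [e3, this]; field_simp
    rw [hC2, hL1, hL2, e1, e2]
    field_simp
    ring
  set C := kernelBound q with hC
  -- This weight balances the two terms: `η L1 / 2 + L2 / (2 η) = √(L1 L2) = C`.
  set η : ℝ := C / L1 with hη
  have hη0 : 0 < η := by positivity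
  let Φ1 : ℂ → ℂ := fun w => (1 + q) / (1 - β ^ 2 * q ^ 2) * ((1 + β * w ^ 2) / (1 - β * w ^ 2)) +
        2 * w / ((1 - β * q) * (1 - β * w ^ 2))
  let Φ2 : ℂ → ℂ := fun w => 1 + q + (1 - β) ^ 2 * q ^ 2 / (1 - q) +
        2 * (1 + q * (1 - β) + (1 - β) ^ 2 * q ^ 2 / (1 - q)) * w +
        2 * ((1 - β) * (1 + q) + (1 - β) ^ 2 * q ^ 2 / (1 - q)) * (w ^ 2 / (1 - w))
  have hne1 : ∀ w : ℂ, ‖w‖ < 1 → 1 - (β : ℂ) * w ^ 2 ≠ 0 := by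
    intro w hw h
    have h' : (β : ℂ) * w ^ 2 = 1 := (sub_eq_zero.1 h).symm
    have h'' := congrArg norm h'
    rw [norm_mul, norm_pow, Complex.norm_real, Real.norm_of_nonneg hβ0.le, norm_one] at h''
    nlinarith [norm_nonneg w]
  have hne2 : ∀ w : ℂ, ‖w‖ < 1 → 1 - w ≠ 0 := by
    intro w hw h
    rw [← sub_eq_zero.1 h, norm_one] at hw
    exact lt_irrefl _ hw
  have hβq1 : 1 - β * q ≠ 0 := by nlinarith
  have hβqc : 1 - (β : ℂ) * q ≠ 0 := by exact_mod_cast hβq1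
  refine ⟨fun w => (η : ℂ) / 2 * Φ1 w + ((η⁻¹ : ℝ) : ℂ) / 2 * Φ2 w, ?_, ?_, ?_⟩
  · intro w hw
    rw [mem_ball_zero_iff] at hw
    have a1 := hne1 w hw
    have a2 := hne2 w hw
    have a3 : (1 - (β : ℂ) * q) * (1 - (β : ℂ) * w ^ 2) ≠ 0 := mul_ne_zero hβqc a1
    apply DifferentiableAt.differentiableWithinAt
    fun_prop (disch := assumption)
  · have e1 : Φ1 0 = (L1 : ℂ) := by simp [Φ1, hL1]
    have e2 : Φ2 0 = (L2 : ℂ) := by simp [Φ2, hL2]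
    simp only [e1, e2]
    have : η / 2 * L1 + η⁻¹ / 2 * L2 = C := by
      have : L2 = C ^ 2 / L1 := by rw [← hL12]; field_simp
      rw [this, hη]
      field_simp
      ring
    exact_mod_cast this
  · intro w hw
    have hn : Complex.normSq w = q := by rw [Complex.normSq_eq_norm_sq, hw]
    have hw1 : ‖w‖ < 1 := by rwa [hw]
    have E1 := normSq_one_add_div β q w hn (hne1 w hw1) hβq1 (by linarith)
    have E2 := normSq_one_sub_div β q w hn (hne2 w hw1) (by linarith)
    rw [Complex.normSq_eq_norm_sq] at E1 E2
    have hre : ((η : ℂ) / 2 * Φ1 w + ((η⁻¹ : ℝ) : ℂ) / 2 * Φ2 w).re =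
        η / 2 * (Φ1 w).re + η⁻¹ / 2 * (Φ2 w).re := by
      rw [← Complex.ofReal_ofNat, ← Complex.ofReal_div, ← Complex.ofReal_div, Complex.add_re,
        Complex.re_ofReal_mul, Complex.re_ofReal_mul]
    have hsplit : (1 + w) / (1 - w) =
        ((1 + w) / (1 - β * w ^ 2)) * ((1 - β * w ^ 2) / (1 - w)) := by
      rw [div_mul_div_comm, mul_comm (1 + w), mul_div_mul_left _ _ (hne1 w hw1)]
    rw [hre, ← E1, ← E2, hsplit, norm_mul]
    set X := ‖(1 + w) / (1 - (β : ℂ) * w ^ 2)‖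
    set Y := ‖(1 - (β : ℂ) * w ^ 2) / (1 - w)‖
    have : η / 2 * X ^ 2 + η⁻¹ / 2 * Y ^ 2 - X * Y = η⁻¹ / 2 * (η * X - Y) ^ 2 := by
      field_simp
      ring
    have : 0 ≤ η⁻¹ / 2 * (η * X - Y) ^ 2 := by positivity
    linarith

/-! ### Interpolation error on a Bernstein ellipse, in one variable -/

/-- The Joukowski map. -/
def joukowski (w : ℂ) : ℂ := (w + w⁻¹) / 2

theorem joukowski_mem {ρ : ℝ} {w : ℂ} (h1 : ρ⁻¹ < ‖w‖) (h2 : ‖w‖ < ρ) :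
    joukowski w ∈ bernsteinEllipse ρ := ⟨w, h1, h2, rfl⟩

theorem ofReal_mem_bernsteinEllipse {ρ : ℝ} (hρ : 1 < ρ) {x : ℝ} (hx : |x| ≤ 1) :
    (x : ℂ) ∈ bernsteinEllipse ρ := by
  have hx' := abs_le.1 hx
  refine ⟨Complex.exp (Real.arccos x * Complex.I), ?_, ?_, ?_⟩
  · rw [Complex.norm_exp_ofReal_mul_I]; exact inv_lt_one_of_one_lt₀ hρ
  · rwa [Complex.norm_exp_ofReal_mul_I]
  · rw [← Complex.exp_neg, ← neg_mul]
    rw [show (x : ℂ) = ((Real.cos (Real.arccos x) : ℝ) : ℂ) by rw [Real.cos_arccos hx'.1 hx'.2],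
      Complex.ofReal_cos]
    rfl

/-- The Cauchy kernel of the ellipse in the Joukowski coordinate. -/
def ellipseKernel (x : ℝ) (w : ℂ) : ℂ := (w⁻¹ - w) / 2 / (joukowski w - x)

theorem joukowski_sub (t : ℝ) {w : ℂ} (hw : w ≠ 0) :
    joukowski w - Real.cos t = w⁻¹ / 2 * ((1 - Complex.exp (t * Complex.I) * w) *
      (1 - (Complex.exp (t * Complex.I))⁻¹ * w)) := by
  have h : ((Real.cos t : ℝ) : ℂ) =
      (Complex.exp (t * Complex.I) + (Complex.exp (t * Complex.I))⁻¹) / 2 := by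
    rw [Complex.ofReal_cos, ← Complex.exp_neg, ← neg_mul]
    rfl
  have h0 := Complex.exp_ne_zero (t * Complex.I)
  rw [h, joukowski]
  generalize Complex.exp (t * Complex.I) = a at *
  field_simp
  ring

theorem one_sub_ne_zero_of_norm_lt {z : ℂ} (h : ‖z‖ < 1) : 1 - z ≠ 0 := by
  intro h'
  rw [← sub_eq_zero.1 h', norm_one] at h
  exact lt_irrefl _ h

theorem norm_exp_inv (t : ℝ) : ‖(Complex.exp (t * Complex.I))⁻¹‖ = 1 := by
  rw [norm_inv, Complex.norm_exp_ofReal_mul_I, inv_one]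

theorem joukowski_sub_ne_zero {x : ℝ} (hx : |x| ≤ 1) {w : ℂ} (hw : w ≠ 0) (h1 : ‖w‖ < 1) :
    joukowski w - x ≠ 0 := by
  have hx' := abs_le.1 hx
  rw [← Real.cos_arccos hx'.1 hx'.2, joukowski_sub _ hw]
  refine mul_ne_zero (div_ne_zero (inv_ne_zero hw) two_ne_zero) (mul_ne_zero ?_ ?_) <;>
  apply one_sub_ne_zero_of_norm_lt <;>
  simpa [norm_exp_inv] using h1

/-- Partial fractions of `(1 - w²) / ((1 - a w) (1 - b w))` with `a b = 1`. The kernel becomes the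
mean of two rotations of `(1 + w) / (1 - w)`, which is analytic in the disc and equals `1` at `0`.
-/
theorem ellipseKernel_cos (t : ℝ) {w : ℂ} (hw : w ≠ 0) (h1 : ‖w‖ < 1) :
    ellipseKernel (Real.cos t) w =
      ((1 + Complex.exp (t * Complex.I) * w) / (1 - Complex.exp (t * Complex.I) * w) +
      (1 + (Complex.exp (t * Complex.I))⁻¹ * w) /
        (1 - (Complex.exp (t * Complex.I))⁻¹ * w)) / 2 := by
  rw [ellipseKernel, joukowski_sub t hw]
  have e1 : 1 - Complex.exp (t * Complex.I) * w ≠ 0 := by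
    apply one_sub_ne_zero_of_norm_lt
    rwa [norm_mul, Complex.norm_exp_ofReal_mul_I, one_mul]
  have e2 : 1 - (Complex.exp (t * Complex.I))⁻¹ * w ≠ 0 := by
    apply one_sub_ne_zero_of_norm_lt
    rwa [norm_mul, norm_exp_inv, one_mul]
  have e3 : Complex.exp (t * Complex.I) * (Complex.exp (t * Complex.I))⁻¹ = 1 :=
    mul_inv_cancel₀ (Complex.exp_ne_zero _)
  generalize (Complex.exp (t * Complex.I))⁻¹ = b at *
  generalize Complex.exp (t * Complex.I) = a at *
  have hw2 : w ^ 2 = (1 - (1 - a * w)) * (1 - (1 - b * w)) := by linear_combination -w ^ 2 * e3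
  rw [show 1 + a * w = 2 - (1 - a * w) by ring, show 1 + b * w = 2 - (1 - b * w) by ring]
  generalize 1 - a * w = p at *
  generalize 1 - b * w = s at *
  field_simp
  linear_combination -2 * hw2

theorem circleAverage_comp_mul_unit {Ψ : ℂ → ℂ} (hΨ : DifferentiableOn ℂ Ψ (Metric.ball 0 1))
    {r : ℝ} (h0 : 0 < r) (h1 : r < 1) {a : ℂ} (ha : ‖a‖ = 1) :
    DifferentiableOn ℂ (fun w => Ψ (a * w)) (Metric.ball 0 1) ∧
      Real.circleAverage (fun w => Ψ (a * w)) 0 r = Ψ 0 := by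
  have hd : DifferentiableOn ℂ (fun w => Ψ (a * w)) (Metric.ball 0 1) := by
    refine hΨ.comp (by fun_prop) ?_
    intro w hw
    rw [mem_ball_zero_iff] at hw ⊢
    rwa [norm_mul, ha, one_mul]
  refine ⟨hd, ?_⟩
  have hc : DiffContOnCl ℂ (fun w => Ψ (a * w)) (Metric.ball 0 |r|) := by
    refine DifferentiableOn.diffContOnCl (hd.mono ?_)
    rw [closure_ball _ (by positivity), abs_of_pos h0]
    exact Metric.closedBall_subset_ball h1
  rw [hc.circleAverage, mul_zero]

theorem circleIntegrable_of_differentiableOn {Ψ : ℂ → ℂ}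
    (hΨ : DifferentiableOn ℂ Ψ (Metric.ball 0 1)) {r : ℝ} (h0 : 0 < r) (h1 : r < 1) :
    CircleIntegrable Ψ 0 r := by
  refine ContinuousOn.circleIntegrable h0.le (hΨ.continuousOn.mono ?_)
  exact Metric.sphere_subset_closedBall.trans (Metric.closedBall_subset_ball h1)

theorem circleAverage_ellipseKernel {x : ℝ} (hx : |x| ≤ 1) {r : ℝ} (h0 : 0 < r) (h1 : r < 1) :
    Real.circleAverage (ellipseKernel x) 0 r = 1 := by
  have hx' := abs_le.1 hx
  set t := Real.arccos x
  have hxt : x = Real.cos t := (Real.cos_arccos hx'.1 hx'.2).symm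
  have hQ : DifferentiableOn ℂ (fun w : ℂ => (1 + w) / (1 - w)) (Metric.ball 0 1) := by
    intro w hw
    have := one_sub_ne_zero_of_norm_lt (mem_ball_zero_iff.1 hw)
    apply DifferentiableAt.differentiableWithinAt
    fun_prop (disch := assumption)
  obtain ⟨d1, v1⟩ := circleAverage_comp_mul_unit hQ h0 h1 (Complex.norm_exp_ofReal_mul_I t)
  obtain ⟨d2, v2⟩ := circleAverage_comp_mul_unit hQ h0 h1 (norm_exp_inv t)
  have i1 := circleIntegrable_of_differentiableOn d1 h0 h1
  have i2 := circleIntegrable_of_differentiableOn d2 h0 h1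
  have : Real.circleAverage (ellipseKernel x) 0 r = Real.circleAverage
      (fun w => (2⁻¹ : ℝ) • ((1 + Complex.exp (t * Complex.I) * w) /
        (1 - Complex.exp (t * Complex.I) * w) +
      (1 + (Complex.exp (t * Complex.I))⁻¹ * w) /
        (1 - (Complex.exp (t * Complex.I))⁻¹ * w))) 0 r := by
    refine Real.circleAverage_congr_sphere fun w hw => ?_
    rw [mem_sphere_zero_iff_norm, abs_of_pos h0] at hw
    have hw0 : w ≠ 0 := by rw [← norm_pos_iff, hw]; exact h0
    rw [hxt, ellipseKernel_cos t hw0 (by rwa [hw]), Complex.real_smul]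
    push_cast
    ring
  rw [this, Real.circleAverage_fun_smul, Real.circleAverage_fun_add i1 i2, v1, v2]
  norm_num

theorem differentiableAt_joukowski {w : ℂ} (hw : w ≠ 0) : DifferentiableAt ℂ joukowski w := by
  unfold joukowski
  fun_prop (disch := assumption)

theorem differentiableAt_dslope {g : ℂ → ℂ} {a z : ℂ} (ha : AnalyticAt ℂ g a)
    (hz : AnalyticAt ℂ g z) : DifferentiableAt ℂ (dslope g a) z := by
  rcases eq_or_ne z a with rfl | h
  · obtain ⟨p, hp⟩ := ha
    exact hp.has_fpower_series_dslope_fslope.analyticAt.differentiableAt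
  · exact (differentiableAt_dslope_of_ne h).2 hz.differentiableAt

variable {ρ : ℝ} {g : ℂ → ℂ}

/-- Cauchy's formula in the Joukowski coordinate. After subtracting `g x` from `g`, the integrand
extends analytically to the annulus `1/ρ < |w| < ρ`, so its mean may be moved to the unit circle,
where symmetry makes it vanish. The remaining term is `g x` times the mean `1` of the kernel. -/
theorem circleAverage_mul_ellipseKernel (hρ : 1 < ρ)
    (hg : AnalyticOnNhd ℂ g (bernsteinEllipse ρ)) {x : ℝ} (hx : |x| ≤ 1) {r : ℝ}
    (h0 : ρ⁻¹ < r) (h1 : r < 1) :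
    Real.circleAverage (fun w => g (joukowski w) * ellipseKernel x w) 0 r = g x := by
  have hρ0 : 0 < ρ⁻¹ := by positivity
  have hr : 0 < r := hρ0.trans h0
  set f : ℂ → ℂ := fun w => dslope g x (joukowski w) * ((w⁻¹ - w) / 2) with hf
  have hxmem := ofReal_mem_bernsteinEllipse hρ hx
  have hdiff : ∀ w : ℂ, ρ⁻¹ < ‖w‖ → ‖w‖ < ρ → DifferentiableAt ℂ f w := by
    intro w hw1 hw2
    have hw0 : w ≠ 0 := norm_pos_iff.1 (hρ0.trans hw1)
    have hd := differentiableAt_dslope (hg _ hxmem) (hg _ (joukowski_mem hw1 hw2))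
    have hd' : DifferentiableAt ℂ (fun w => dslope g x (joukowski w)) w :=
      hd.comp w (differentiableAt_joukowski hw0)
    refine hd'.mul ?_
    fun_prop (disch := assumption)
  have hann : Real.circleAverage f 0 1 = Real.circleAverage f 0 r := by
    rw [Real.circleAverage_eq_circleIntegral one_ne_zero,
      Real.circleAverage_eq_circleIntegral hr.ne']
    congr 1
    refine Complex.circleIntegral_sub_center_inv_smul_eq_of_differentiable_on_annulus_off_countable
      hr h1.le Set.countable_empty ?_ ?_
    · intro w hw
      simp only [Set.mem_sdiff, mem_closedBall_zero_iff, mem_ball_zero_iff, not_lt] at hw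
      exact (hdiff w (by linarith) (by linarith)).continuousAt.continuousWithinAt
    · intro w hw
      simp only [Set.mem_sdiff, mem_closedBall_zero_iff, mem_ball_zero_iff, not_le] at hw
      exact hdiff w (by linarith) (by linarith)
  -- Under `w ↦ w⁻¹` the Joukowski map is invariant and `w⁻¹ - w` changes sign, so the mean on the
  -- unit circle equals its own negative.
  have hodd : Real.circleAverage f 0 1 = 0 := by
    have h := Real.circleAverage_zero_one_congr_inv (f := f)
    have hneg : (fun w => f w⁻¹) = fun w => (-1 : ℝ) • f w := by
      funext w
      simp only [hf, joukowski, inv_inv, add_comm w⁻¹ w, neg_smul, one_smul]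
      ring
    rw [hneg, Real.circleAverage_fun_smul, neg_smul, one_smul] at h
    exact self_eq_neg.1 h.symm
  have hif : CircleIntegrable f 0 r := by
    refine ContinuousOn.circleIntegrable hr.le fun w hw => ?_
    rw [mem_sphere_zero_iff_norm] at hw
    exact (hdiff w (by linarith) (by linarith)).continuousAt.continuousWithinAt
  have hiK : CircleIntegrable (ellipseKernel x) 0 r := by
    refine ContinuousOn.circleIntegrable hr.le fun w hw => ?_
    rw [mem_sphere_zero_iff_norm] at hw
    have hw0 : w ≠ 0 := norm_pos_iff.1 (hw ▸ hr)
    have hd := joukowski_sub_ne_zero hx hw0 (by linarith)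
    have := differentiableAt_joukowski hw0
    have : DifferentiableAt ℂ (ellipseKernel x) w := by
      unfold ellipseKernel
      fun_prop (disch := assumption)
    exact this.continuousAt.continuousWithinAt
  have hsum : Real.circleAverage (fun w => g (joukowski w) * ellipseKernel x w) 0 r =
      Real.circleAverage (fun w => f w + g x • ellipseKernel x w) 0 r := by
    refine Real.circleAverage_congr_sphere fun w hw => ?_
    rw [mem_sphere_zero_iff_norm, abs_of_pos hr] at hw
    have hw0 : w ≠ 0 := norm_pos_iff.1 (hw ▸ hr)
    have hd := joukowski_sub_ne_zero hx hw0 (by linarith)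
    have hne : joukowski w ≠ x := sub_ne_zero.1 hd
    simp only [hf, dslope_of_ne _ hne, slope_def_field, ellipseKernel, smul_eq_mul]
    field_simp
    ring
  have hiK' : CircleIntegrable (fun w => g x • ellipseKernel x w) 0 r := hiK.const_smul
  rw [hsum, Real.circleAverage_fun_add hif hiK', ← hann, hodd, Real.circleAverage_fun_smul,
    circleAverage_ellipseKernel hx hr h1, zero_add, smul_eq_mul, mul_one]

theorem eval_T_joukowski (n : ℕ) {w : ℂ} (hw : w ≠ 0) :
    (Polynomial.Chebyshev.T ℂ (n : ℤ)).eval (joukowski w) = (w ^ n + (w ^ n)⁻¹) / 2 := by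
  have h : joukowski w = Complex.cosh (Complex.log w) := by
    rw [Complex.cosh, Complex.exp_neg, Complex.exp_log hw]
    rfl
  rw [h, Polynomial.Chebyshev.T_complex_cosh, Complex.cosh, Complex.exp_neg]
  push_cast
  rw [Complex.exp_nat_mul, Complex.exp_log hw]

theorem norm_eval_T_joukowski_ge (n : ℕ) {w : ℂ} {r : ℝ} (h0 : 0 < r) (hw : ‖w‖ = r) :
    (1 - (r ^ 2) ^ n) / (2 * r ^ n) ≤
      ‖(Polynomial.Chebyshev.T ℂ (n : ℤ)).eval (joukowski w)‖ := by
  have hw0 : w ≠ 0 := norm_pos_iff.1 (hw ▸ h0)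
  rw [eval_T_joukowski n hw0, norm_div, Complex.norm_ofNat]
  have h := norm_sub_norm_le ((w ^ n)⁻¹) (-(w ^ n))
  rw [norm_inv, norm_neg, norm_pow, hw, sub_neg_eq_add, add_comm] at h
  have : (1 - (r ^ 2) ^ n) / (2 * r ^ n) = ((r ^ n)⁻¹ - r ^ n) / 2 := by
    field_simp
    ring
  rw [this]
  linarith

/-- The bound, relative to the bound of the function on the ellipse, of the interpolation error in
one variable; `r` is the inverse of the parameter of the ellipse and `N` the number of nodes. -/
def errBound (N : ℕ) (r : ℝ) : ℝ := 2 * r ^ N / (1 - (r ^ 2) ^ N) * kernelBound (r ^ 2)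

/-- Hermite's remainder formula: by Cauchy's formula the error is the interpolation error of the
kernel `1 / (z - x)`, averaged over the contour, and that one is explicit. The sup norm bounds `g`
and the Chebyshev quotient; `exists_majorant` bounds the mean of the kernel's modulus. -/
theorem norm_sub_interp_le (hρ : 1 < ρ) (hg : AnalyticOnNhd ℂ g (bernsteinEllipse ρ)) {B : ℝ}
    (hB : ∀ z ∈ bernsteinEllipse ρ, ‖g z‖ ≤ B) (m : ℕ) {x : ℝ} (hx : |x| ≤ 1) {r : ℝ}
    (h0 : ρ⁻¹ < r) (h1 : r < 1) :
    ‖g x - ∑ j, (chebLagrange m j x : ℂ) * g (chebNode m j)‖ ≤ B * errBound (m + 1) r := by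
  have hρ0 : 0 < ρ⁻¹ := by positivity
  have hr : 0 < r := hρ0.trans h0
  have hB0 : 0 ≤ B := (norm_nonneg _).trans (hB _ (ofReal_mem_bernsteinEllipse hρ hx))
  have hq1 : (r ^ 2) ^ (m + 1) < 1 := pow_lt_one₀ (by positivity) (by nlinarith) (by omega)
  set T := Polynomial.Chebyshev.T ℂ ((m : ℤ) + 1) with hT
  have hTge : ∀ w : ℂ, ‖w‖ = r → (1 - (r ^ 2) ^ (m + 1)) / (2 * r ^ (m + 1)) ≤
      ‖T.eval (joukowski w)‖ := by
    intro w hw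
    have := norm_eval_T_joukowski_ge (m + 1) hr hw
    push_cast at this
    exact this
  have hTpos : 0 < (1 - (r ^ 2) ^ (m + 1)) / (2 * r ^ (m + 1)) :=
    div_pos (by linarith) (by positivity)
  have hTne : ∀ w : ℂ, ‖w‖ = r → T.eval (joukowski w) ≠ 0 := fun w hw =>
    norm_pos_iff.1 (hTpos.trans_le (hTge w hw))
  have hTx : ‖T.eval (x : ℂ)‖ ≤ 1 := by
    rw [hT, ← Polynomial.Chebyshev.complex_ofReal_eval_T, Complex.norm_real]
    exact Polynomial.Chebyshev.abs_eval_T_real_le_one _ hx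
  have hcont : ∀ y : ℝ, |y| ≤ 1 →
      ContinuousOn (fun w => g (joukowski w) * ellipseKernel y w) (Metric.sphere 0 r) := by
    intro y hy w hw
    rw [mem_sphere_zero_iff_norm] at hw
    have hw0 : w ≠ 0 := norm_pos_iff.1 (hw ▸ hr)
    have hd := joukowski_sub_ne_zero hy hw0 (by linarith)
    have h3 := differentiableAt_joukowski hw0
    have h4 : DifferentiableAt ℂ (ellipseKernel y) w := by
      unfold ellipseKernel
      fun_prop (disch := assumption)
    have h5 : DifferentiableAt ℂ (fun w => g (joukowski w)) w :=
      (hg _ (joukowski_mem (by linarith) (by linarith))).differentiableAt.comp w h3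
    exact (h5.mul h4).continuousAt.continuousWithinAt
  have hint : ∀ y : ℝ, |y| ≤ 1 →
      CircleIntegrable (fun w => g (joukowski w) * ellipseKernel y w) 0 r := fun y hy =>
    ContinuousOn.circleIntegrable hr.le (hcont y hy)
  have hrepr : ∀ y : ℝ, |y| ≤ 1 → g y =
      Real.circleAverage (fun w => g (joukowski w) * ellipseKernel y w) 0 r := fun y hy =>
    (circleAverage_mul_ellipseKernel hρ hg hy h0 h1).symm
  have hsm : ∀ j, CircleIntegrable (fun w => (chebLagrange m j x : ℂ) •
      (g (joukowski w) * ellipseKernel (chebNode m j) w)) 0 r := fun j =>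
    (hint _ (abs_chebNode_le m j)).const_smul
  have herr : g x - ∑ j, (chebLagrange m j x : ℂ) * g (chebNode m j) =
      Real.circleAverage (fun w => g (joukowski w) * ellipseKernel x w *
        (T.eval (x : ℂ) / T.eval (joukowski w))) 0 r := by
    have hs : ∑ j, (chebLagrange m j x : ℂ) * g (chebNode m j) = Real.circleAverage
        (fun w => ∑ j, (chebLagrange m j x : ℂ) •
          (g (joukowski w) * ellipseKernel (chebNode m j) w)) 0 r := by
      rw [Real.circleAverage_fun_sum fun j _ => hsm j]
      refine Finset.sum_congr rfl fun j _ => ?_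
      rw [Real.circleAverage_fun_smul, ← hrepr _ (abs_chebNode_le m j), smul_eq_mul]
    rw [hs, hrepr x hx, ← Real.circleAverage_fun_sub (hint x hx)
      (CircleIntegrable.fun_sum _ fun j _ => hsm j)]
    refine Real.circleAverage_congr_sphere fun w hw => ?_
    rw [mem_sphere_zero_iff_norm, abs_of_pos hr] at hw
    have hw0 : w ≠ 0 := norm_pos_iff.1 (hw ▸ hr)
    have hd := joukowski_sub_ne_zero hx hw0 (by linarith)
    have hres := sum_chebLagrange_mul_inv m x (joukowski w) (sub_ne_zero.1 hd) (hTne w hw)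
    have e : ∑ j, (chebLagrange m j x : ℂ) • (g (joukowski w) * ellipseKernel (chebNode m j) w) =
        g (joukowski w) * ((w⁻¹ - w) / 2) *
          ∑ j, (chebLagrange m j x : ℂ) * (joukowski w - chebNode m j)⁻¹ := by
      rw [Finset.mul_sum]
      refine Finset.sum_congr rfl fun j _ => ?_
      rw [ellipseKernel, smul_eq_mul]
      ring
    simp only [e, hres, ← hT]
    rw [ellipseKernel]
    ring
  obtain ⟨Ψ, hΨd, hΨ0, hΨ⟩ := exists_majorant hr h1
  have hx' := abs_le.1 hx
  set t := Real.arccos x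
  have hxt : x = Real.cos t := (Real.cos_arccos hx'.1 hx'.2).symm
  obtain ⟨d1, v1⟩ := circleAverage_comp_mul_unit hΨd hr h1 (Complex.norm_exp_ofReal_mul_I t)
  obtain ⟨d2, v2⟩ := circleAverage_comp_mul_unit hΨd hr h1 (norm_exp_inv t)
  have i1 := circleIntegrable_of_differentiableOn d1 hr h1
  have i2 := circleIntegrable_of_differentiableOn d2 hr h1
  set c : ℝ := B * (2 * r ^ (m + 1) / (1 - (r ^ 2) ^ (m + 1))) / 2 with hc
  have hc0 : 0 ≤ c := by
    have : 0 < 1 - (r ^ 2) ^ (m + 1) := by linarith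
    positivity
  set F : ℂ → ℂ := fun w => (c : ℂ) • (Ψ (Complex.exp (t * Complex.I) * w) +
    Ψ ((Complex.exp (t * Complex.I))⁻¹ * w)) with hF
  have hFi : CircleIntegrable F 0 r := (i1.add i2).const_smul
  have hFavg : Real.circleAverage F 0 r = ((B * errBound (m + 1) r : ℝ) : ℂ) := by
    rw [hF, Real.circleAverage_fun_smul, Real.circleAverage_fun_add i1 i2, v1, v2, hΨ0, hc,
      errBound,
      smul_eq_mul]
    push_cast
    ring
  have hpt : ∀ w : ℂ, ‖w‖ = r → ‖g (joukowski w) * ellipseKernel x w *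
        (T.eval (x : ℂ) / T.eval (joukowski w))‖ ≤ (F w).re := by
    intro w hw
    have hw0 : w ≠ 0 := norm_pos_iff.1 (hw ▸ hr)
    have b1 : ‖g (joukowski w)‖ ≤ B := hB _ (joukowski_mem (by linarith) (by linarith))
    have b2 : ‖T.eval (x : ℂ) / T.eval (joukowski w)‖ ≤
        2 * r ^ (m + 1) / (1 - (r ^ 2) ^ (m + 1)) := by
      rw [norm_div, show 2 * r ^ (m + 1) / (1 - (r ^ 2) ^ (m + 1)) =
        1 / ((1 - (r ^ 2) ^ (m + 1)) / (2 * r ^ (m + 1))) by rw [one_div_div]]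
      exact div_le_div₀ zero_le_one hTx hTpos (hTge w hw)
    have b3 : ‖ellipseKernel x w‖ ≤ ((Ψ (Complex.exp (t * Complex.I) * w)).re +
        (Ψ ((Complex.exp (t * Complex.I))⁻¹ * w)).re) / 2 := by
      rw [hxt, ellipseKernel_cos t hw0 (by rwa [hw]), norm_div, Complex.norm_ofNat]
      have c1 := hΨ (Complex.exp (t * Complex.I) * w)
        (by rw [norm_mul, Complex.norm_exp_ofReal_mul_I, one_mul, hw])
      have c2 := hΨ ((Complex.exp (t * Complex.I))⁻¹ * w)
        (by rw [norm_mul, norm_exp_inv, one_mul, hw])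
      have := norm_add_le
        ((1 + Complex.exp (t * Complex.I) * w) / (1 - Complex.exp (t * Complex.I) * w))
        ((1 + (Complex.exp (t * Complex.I))⁻¹ * w) / (1 - (Complex.exp (t * Complex.I))⁻¹ * w))
      linarith
    have hFre : (F w).re = c * ((Ψ (Complex.exp (t * Complex.I) * w)).re +
        (Ψ ((Complex.exp (t * Complex.I))⁻¹ * w)).re) := by
      rw [hF]
      simp only [smul_eq_mul, Complex.re_ofReal_mul, Complex.add_re]
    rw [hFre, norm_mul, norm_mul]
    calc _ ≤ B * (((Ψ (Complex.exp (t * Complex.I) * w)).re +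
        (Ψ ((Complex.exp (t * Complex.I))⁻¹ * w)).re) / 2) *
          (2 * r ^ (m + 1) / (1 - (r ^ 2) ^ (m + 1))) := by
          have := (norm_nonneg _).trans b3
          gcongr
      _ = _ := by rw [hc]; ring
  have hre : Real.circleAverage (fun w => (F w).re) 0 r = B * errBound (m + 1) r := by
    have := Complex.reCLM.circleAverage_comp_comm hFi
    rw [hFavg] at this
    simpa [Function.comp_def] using this
  rw [herr, ← hre, Real.circleAverage_def, Real.circleAverage_def, norm_smul,
    Real.norm_of_nonneg (by positivity), smul_eq_mul]
  gcongr
  refine intervalIntegral.norm_integral_le_of_norm_le (by positivity) ?_ ?_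
  · exact Filter.Eventually.of_forall fun s _ => hpt _ (by simp [abs_of_pos hr])
  · exact ⟨Complex.reCLM.integrable_comp hFi.1, Complex.reCLM.integrable_comp hFi.2⟩

/-! ### Tensor interpolation of analytic functions -/

/-- The factor `2 / π * log (m + 1) + 1` bounding the Lebesgue constant in one variable. -/
def lebesgueBound (m : ℕ) : ℝ := 2 / Real.pi * Real.log ((m : ℝ) + 1) + 1

theorem lebesgueFactor_eq (d m : ℕ) : lebesgueFactor d m = lebesgueBound m ^ d := rfl

theorem norm_interp_le (m : ℕ) (v : Fin (m + 1) → ℂ) {B : ℝ} (hv : ∀ j, ‖v j‖ ≤ B) {x : ℝ}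
    (hx : |x| ≤ 1) : ‖∑ j, (chebLagrange m j x : ℂ) * v j‖ ≤ lebesgueBound m * B := by
  have hB0 : 0 ≤ B := (norm_nonneg _).trans (hv 0)
  calc _ ≤ ∑ j, |chebLagrange m j x| * B := by
        refine norm_sum_le_of_le _ fun j _ => ?_
        rw [norm_mul, Complex.norm_real, Real.norm_eq_abs]
        gcongr
        exact hv j
    _ ≤ _ := by
        rw [← Finset.sum_mul]
        gcongr
        exact sum_abs_chebLagrange_le m hx

variable {E : Set ℂ} {m : ℕ}

/-- Interpolating the first coordinate costs `B e` and leaves a function `F₁` of `d` variables,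
still separately analytic and bounded by `lam * B`; the induction sums a geometric series. The
one-variable bounds are hypotheses so that `lam` can be chosen later. -/
theorem norm_sub_tensor_interp_le {e lam : ℝ}
    (hE : ∀ x : ℝ, |x| ≤ 1 → (x : ℂ) ∈ E)
    (h1 : ∀ (g : ℂ → ℂ) (B : ℝ), AnalyticOnNhd ℂ g E → (∀ z ∈ E, ‖g z‖ ≤ B) → ∀ x : ℝ, |x| ≤ 1 →
      ‖g x - ∑ j, (chebLagrange m j x : ℂ) * g (chebNode m j)‖ ≤ B * e)
    (h2 : ∀ (g : ℂ → ℂ) (B : ℝ), AnalyticOnNhd ℂ g E → (∀ z ∈ E, ‖g z‖ ≤ B) → ∀ x : ℝ, |x| ≤ 1 →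
      ‖∑ j, (chebLagrange m j x : ℂ) * g (chebNode m j)‖ ≤ lam * B) (d : ℕ) :
    ∀ (F : (Fin d → ℂ) → ℂ) (B : ℝ),
      (∀ z : Fin d → ℂ, (∀ i, z i ∈ E) → ∀ i,
        AnalyticOnNhd ℂ (fun t => F (Function.update z i t)) E) →
      (∀ z : Fin d → ℂ, (∀ i, z i ∈ E) → ‖F z‖ ≤ B) →
      ∀ x : Fin d → ℝ, (∀ i, |x i| ≤ 1) →
      ‖F (fun i => (x i : ℂ)) - ∑ j : Fin d → Fin (m + 1),
        (∏ i, (chebLagrange m (j i) (x i) : ℂ)) * F (fun i => (chebNode m (j i) : ℂ))‖ ≤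
      B * (e * ∑ i ∈ Finset.range d, lam ^ i) := by
  induction d with
  | zero =>
    intro F B _ _ x _
    rw [Fintype.sum_unique]
    simp only [Finset.univ_eq_empty, Finset.prod_empty, one_mul, Finset.range_zero,
      Finset.sum_empty, mul_zero]
    have h : ∀ a b : Fin 0 → ℂ, ‖F a - F b‖ ≤ 0 := fun a b => by
      rw [Subsingleton.elim a b, sub_self, norm_zero]
    exact h _ _
  | succ d ih =>
    intro F B hF hB x hx
    have hmem : ∀ {t : ℂ} {z : Fin d → ℂ}, t ∈ E → (∀ i, z i ∈ E) →
        ∀ i, (Fin.cons t z : Fin (d + 1) → ℂ) i ∈ E := by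
      intro t z ht hz i
      refine Fin.cases ?_ (fun i => ?_) i
      · simpa using ht
      · simpa using hz i
    have hx0 := hE _ (hx 0)
    have hnode : ∀ j, (chebNode m j : ℂ) ∈ E := fun j => hE _ (abs_chebNode_le m j)
    have hsl : ∀ z : Fin d → ℂ, (∀ i, z i ∈ E) →
        AnalyticOnNhd ℂ (fun t => F (Fin.cons t z)) E := by
      intro z hz
      have := hF (Fin.cons (x 0 : ℂ) z) (hmem hx0 hz) 0
      simpa only [Fin.update_cons_zero] using this
    set F₁ : (Fin d → ℂ) → ℂ := fun z =>
      ∑ j, (chebLagrange m j (x 0) : ℂ) * F (Fin.cons (chebNode m j : ℂ) z) with hF₁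
    have hF₁B : ∀ z : Fin d → ℂ, (∀ i, z i ∈ E) → ‖F₁ z‖ ≤ lam * B := fun z hz =>
      h2 (fun t => F (Fin.cons t z)) B (hsl z hz) (fun t ht => hB _ (hmem ht hz)) (x 0) (hx 0)
    have hF₁a : ∀ z : Fin d → ℂ, (∀ i, z i ∈ E) → ∀ i,
        AnalyticOnNhd ℂ (fun t => F₁ (Function.update z i t)) E := by
      intro z hz i t ht
      simp only [hF₁]
      refine Finset.analyticAt_fun_sum _ fun j _ => analyticAt_const.mul ?_
      have := hF (Fin.cons (chebNode m j : ℂ) z) (hmem (hnode j) hz) i.succ t ht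
      simpa only [Fin.cons_update] using this
    have hstep := ih F₁ (lam * B) hF₁a hF₁B (fun i => x i.succ) (fun i => hx _)
    have hxE : ∀ i : Fin d, ((x i.succ : ℝ) : ℂ) ∈ E := fun i => hE _ (hx _)
    have hfirst := h1 (fun t => F (Fin.cons t fun i => (x i.succ : ℂ))) B (hsl _ hxE)
      (fun t ht => hB _ (hmem ht hxE)) (x 0) (hx 0)
    have ex : (Fin.cons (x 0 : ℂ) fun i : Fin d => (x i.succ : ℂ)) = fun i => (x i : ℂ) := by
      funext i
      refine Fin.cases ?_ (fun i => ?_) i <;> simp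
    rw [ex] at hfirst
    have hsum : ∑ j : Fin (d + 1) → Fin (m + 1),
        (∏ i, (chebLagrange m (j i) (x i) : ℂ)) * F (fun i => (chebNode m (j i) : ℂ)) =
        ∑ j : Fin d → Fin (m + 1), (∏ i, (chebLagrange m (j i) (x i.succ) : ℂ)) *
          F₁ (fun i => (chebNode m (j i) : ℂ)) := by
      rw [← (Fin.consEquiv fun _ : Fin (d + 1) => Fin (m + 1)).sum_comp, Fintype.sum_prod_type,
        Finset.sum_comm]
      refine Finset.sum_congr rfl fun j _ => ?_
      rw [hF₁, Finset.mul_sum]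
      refine Finset.sum_congr rfl fun j0 _ => ?_
      have en : (fun i =>
          (chebNode m ((Fin.consEquiv fun _ : Fin (d + 1) => Fin (m + 1)) (j0, j) i) : ℂ)) =
          Fin.cons (chebNode m j0 : ℂ) fun i => (chebNode m (j i) : ℂ) := by
        funext i
        refine Fin.cases ?_ (fun i => ?_) i <;> simp [Fin.consEquiv]
      rw [en, Fin.prod_univ_succ]
      simp only [Fin.consEquiv, Equiv.coe_fn_mk, Fin.cons_zero, Fin.cons_succ]
      ring
    rw [hsum]
    calc _ = ‖(F (fun i => (x i : ℂ)) - F₁ fun i => (x i.succ : ℂ)) +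
          (F₁ (fun i => (x i.succ : ℂ)) - ∑ j : Fin d → Fin (m + 1),
            (∏ i, (chebLagrange m (j i) (x i.succ) : ℂ)) *
              F₁ (fun i => (chebNode m (j i) : ℂ)))‖ := by congr 1; ring
      _ ≤ B * e + lam * B * (e * ∑ i ∈ Finset.range d, lam ^ i) :=
          (norm_add_le _ _).trans (add_le_add hfirst hstep)
      _ = _ := by rw [geom_sum_succ]; ring

namespace Box

variable {d : ℕ} {D : Box d} {ρ B : ℝ} {g : D.toSet → ℝ}

theorem bound_nonneg (hρ : 1 < ρ) (h : HasBoundedAnalyticExtension D ρ B g) : 0 ≤ B := by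
  obtain ⟨F, -, -, hB⟩ := h
  refine (norm_nonneg _).trans (hB (fun i => ((D.U i : ℂ) + (D.L i : ℂ)) / 2) fun i => ?_)
  refine ⟨0, ?_, by simp⟩
  have := ofReal_mem_bernsteinEllipse hρ (x := 0) (by simp)
  simpa using this

/-- Uses only the sup bound and the Lebesgue constant. It serves when the ellipse is so thin that
`errBound` is poor. -/
theorem abs_sub_chebInterp_le_one_add (h : HasBoundedAnalyticExtension D ρ B g) (hρ : 1 < ρ)
    (m : ℕ) (s : D.toSet) :
    |g s - D.chebInterp m (fun j => g ⟨D.node m j, D.node_mem m j⟩) s| ≤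
      B * (1 + lebesgueBound m ^ d) := by
  have hg : ∀ s, |g s| ≤ B := by
    obtain ⟨F, -, hF, hB⟩ := h
    intro s
    have h1 := hB (fun i => ((s : Fin d → ℝ) i : ℂ)) fun i => ?_
    · rwa [hF, Complex.norm_real, Real.norm_eq_abs] at h1
    · refine ⟨(D.theta s i : ℂ), ofReal_mem_bernsteinEllipse hρ (D.abs_theta_le s.2 i), ?_⟩
      have := congrArg Complex.ofReal (D.theta_inv s i)
      push_cast at this
      exact this.symm
  have h2 := D.abs_chebInterp_le m (fun j => g ⟨D.node m j, D.node_mem m j⟩)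
    (fun j => hg _) s.2
  rw [lebesgueFactor_eq] at h2
  have h1 := hg s
  have := abs_sub (g s) (D.chebInterp m (fun j => g ⟨D.node m j, D.node_mem m j⟩) s)
  linarith

theorem abs_sub_chebInterp_le (h : HasBoundedAnalyticExtension D ρ B g) (hρ : 1 < ρ)
    (m : ℕ) {r : ℝ} (h0 : ρ⁻¹ < r) (h1 : r < 1) {lam : ℝ}
    (hlam : lam = lebesgueBound m ∨ lam = 1 + errBound (m + 1) r) (s : D.toSet) :
    |g s - D.chebInterp m (fun j => g ⟨D.node m j, D.node_mem m j⟩) s| ≤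
      B * (errBound (m + 1) r * ∑ i ∈ Finset.range d, lam ^ i) := by
  have hρ0 : 0 < ρ⁻¹ := by positivity
  have hr : 0 < r := hρ0.trans h0
  have hq : r ^ 2 < 1 := by nlinarith
  have hq1 : (r ^ 2) ^ (m + 1) < 1 := pow_lt_one₀ (by positivity) hq (by omega)
  have he : 0 ≤ errBound (m + 1) r := by
    have : 0 < 1 - (r ^ 2) ^ (m + 1) := by linarith
    unfold errBound kernelBound
    positivity
  have hlam0 : 0 ≤ lam := by
    rcases hlam with rfl | rfl
    · have : 0 ≤ Real.log ((m : ℝ) + 1) :=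
        Real.log_nonneg (by linarith [Nat.cast_nonneg (α := ℝ) m])
      have := Real.pi_pos
      unfold lebesgueBound
      positivity
    · positivity
  obtain ⟨F, hFa, hF, hB⟩ := h
  let η : (Fin d → ℂ) → (Fin d → ℂ) := fun z i =>
    ((D.U i : ℂ) - (D.L i : ℂ)) / 2 * z i + ((D.U i : ℂ) + (D.L i : ℂ)) / 2
  have hη : ∀ z : Fin d → ℂ, (∀ i, z i ∈ bernsteinEllipse ρ) → η z ∈ D.bernstein ρ :=
    fun z hz i => ⟨z i, hz i, rfl⟩
  have hupd : ∀ z : Fin d → ℂ, (∀ i, z i ∈ bernsteinEllipse ρ) → ∀ i, ∀ t ∈ bernsteinEllipse ρ,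
      ∀ k, Function.update z i t k ∈ bernsteinEllipse ρ := by
    intro z hz i t ht k
    rcases eq_or_ne k i with rfl | hk
    · simpa using ht
    · simpa [hk] using hz k
  have key := norm_sub_tensor_interp_le (E := bernsteinEllipse ρ) (m := m) (lam := lam)
    (fun x hx => ofReal_mem_bernsteinEllipse hρ hx)
    (fun g B hg hB x hx => norm_sub_interp_le hρ hg hB m hx h0 h1) ?_ d (fun z => F (η z)) B ?_
    (fun z hz => hB _ (hη z hz)) (fun i => D.theta s i) (fun i => D.abs_theta_le s.2 i)
  · have e1 : η (fun i => (D.theta s i : ℂ)) = fun i => ((s : Fin d → ℝ) i : ℂ) := by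
      funext i
      have := D.theta_inv s i
      simp only [η]
      conv_rhs => rw [← this]
      push_cast
      rfl
    have e2 : ∀ j : Fin d → Fin (m + 1), η (fun i => (chebNode m (j i) : ℂ)) =
        fun i => (D.node m j i : ℂ) := by
      intro j
      funext i
      simp only [η, node]
      push_cast
      rfl
    simp only [e1, e2] at key
    have e3 : ∀ j : Fin d → Fin (m + 1), F (fun i => (D.node m j i : ℂ)) =
        (g ⟨D.node m j, D.node_mem m j⟩ : ℂ) := fun j => hF ⟨D.node m j, D.node_mem m j⟩
    simp only [hF s, e3] at key
    rw [D.chebInterp_eq_sum, ← Real.norm_eq_abs, ← Complex.norm_real]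
    convert key using 2
    push_cast
    congr 1
    exact Finset.sum_congr rfl fun j _ => mul_comm _ _
  · intro g B hg hB x hx
    rcases hlam with rfl | rfl
    · exact norm_interp_le m _
        (fun j => hB _ (ofReal_mem_bernsteinEllipse hρ (abs_chebNode_le m j))) hx
    -- The interpolant is at most the function plus the error, hence the alternative growth factor
    -- `1 + errBound`.
    · have a1 := norm_sub_interp_le hρ hg hB m hx h0 h1
      have a2 := hB _ (ofReal_mem_bernsteinEllipse hρ hx)
      have a3 := norm_sub_norm_le (∑ j, (chebLagrange m j x : ℂ) * g (chebNode m j)) (g x)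
      rw [norm_sub_rev] at a3
      linarith
  · intro z hz i t ht
    have hd : Differentiable ℂ (fun t => η (Function.update z i t)) := by
      rw [differentiable_pi]
      intro k
      simp only [η]
      rcases eq_or_ne k i with rfl | hk
      · simp only [Function.update_self]
        fun_prop
      · simp only [Function.update_of_ne hk]
        fun_prop
    exact AnalyticAt.comp (g := F) (f := fun t => η (Function.update z i t))
      (hFa _ (hη _ (hupd z hz i t ht))) (hd.analyticAt t)

end Box

/-! ### Comparison of the interpolation error bounds -/

theorem two_div_pi_le : 2 / Real.pi ≤ 0.6367 := by
  rw [div_le_iff₀ Real.pi_pos]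
  nlinarith [Real.pi_gt_d4]

theorem mul_le_log_inv_of_le_pow {q c : ℝ} {N : ℕ} (h0 : 0 < q) (h1 : q < 1) (hc : 0 < c)
    (h : c ≤ q ^ N) : N * (2 * (1 - q) / (1 + q)) ≤ Real.log c⁻¹ := by
  have a1 : 2 * (1 - q) / (1 + q) ≤ Real.log q⁻¹ := by
    have := Real.le_log_one_add_of_nonneg (x := q⁻¹ - 1) (by linarith [one_lt_inv₀ h0 |>.2 h1])
    have e : 2 * (q⁻¹ - 1) / (q⁻¹ - 1 + 2) = 2 * (1 - q) / (1 + q) := by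
      have e1 : q⁻¹ - 1 = (1 - q) / q := by field_simp
      have e2 : q⁻¹ - 1 + 2 = (1 + q) / q := by field_simp; ring
      rw [e2, e1]
      field_simp
    rw [e] at this
    simpa using this
  have a2 : Real.log c ≤ N * Real.log q := by
    rw [← Real.log_pow]
    exact Real.log_le_log hc h
  rw [Real.log_inv] at a1 ⊢
  nlinarith [mul_le_mul_of_nonneg_left a1 (Nat.cast_nonneg (α := ℝ) N)]

/-- Factor `s² - 1 = (s - 1) (s + 1)` and use tangent lines of `log` at `b = 1` and `s = 2`. The
Lebesgue bound is thereby controlled by a linear function of `s`. -/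
theorem log_le_of_le_mul {n s a b : ℝ} (hn : 0 < n) (hs : 1 < s) (ha : 0 < a) (hb : 0 < b)
    (h : n ≤ a * b * (s ^ 2 - 1) / 3) :
    Real.log n ≤ Real.log a + (b - 1) + 4 / 3 * (s - 2) := by
  have h1 : Real.log n ≤ Real.log (a * b * ((s - 1) * ((s + 1) / 3))) := by
    apply Real.log_le_log hn
    linarith
  have hs1 : 0 < s - 1 := by linarith
  have hs2 : 0 < (s + 1) / 3 := by linarith
  rw [Real.log_mul (by positivity) (by positivity), Real.log_mul ha.ne' hb.ne',
    Real.log_mul hs1.ne' hs2.ne'] at h1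
  have := Real.log_le_sub_one_of_pos hb
  have := Real.log_le_sub_one_of_pos hs1
  have := Real.log_le_sub_one_of_pos hs2
  linarith

theorem kernelBound_pow_four {q : ℝ} (h0 : 0 ≤ q) (h1 : q < 1) :
    kernelBound q ^ 4 * (1 - q) = (1 + q) ^ 3 := by
  have h : 0 < 1 - q ^ 2 := by nlinarith
  have e : √(√(1 - q ^ 2)) ^ 4 = 1 - q ^ 2 := by
    rw [show (4 : ℕ) = 2 * 2 from rfl, pow_mul, Real.sq_sqrt (Real.sqrt_nonneg _),
      Real.sq_sqrt h.le]
  rw [kernelBound, div_pow, e, show 1 - q ^ 2 = (1 + q) * (1 - q) by ring]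
  have : 1 - q ≠ 0 := by linarith
  have : 1 + q ≠ 0 := by linarith
  field_simp

theorem kernelBound_pos {q : ℝ} (h0 : 0 ≤ q) (h1 : q < 1) : 0 < kernelBound q := by
  have h : 0 < 1 - q ^ 2 := by nlinarith
  unfold kernelBound
  positivity

/-- In fourth powers the roots disappear, and the claim becomes `(1 + q)³ (1 - q) ≤ 4 · 0.806⁴`. The
left side has maximum `27/16`, at `q = 1/2`. -/
theorem kernelBound_le {q s : ℝ} (h0 : 0 ≤ q) (hs : 0 < s) (hqs : s ^ 2 * (1 - q) = 2) :
    kernelBound q ≤ 0.806 * s := by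
  have h1 : q < 1 := by
    by_contra h
    nlinarith [sq_nonneg s]
  have hk := kernelBound_pow_four h0 h1
  refine le_of_pow_le_pow_left₀ (n := 4) (by norm_num) (by positivity) ?_
  have h2 : 0 < 1 - q := by linarith
  have e : (0.806 * s) ^ 4 * (1 - q) ^ 2 = 0.806 ^ 4 * 4 := by
    rw [mul_pow, mul_assoc, show s ^ 4 * (1 - q) ^ 2 = (s ^ 2 * (1 - q)) ^ 2 by ring, hqs]
    norm_num
  have h3 : (1 + q) ^ 3 * (1 - q) ≤ 27 / 16 := by
    nlinarith [mul_nonneg (sq_nonneg (q - 1 / 2)) (sq_nonneg q), sq_nonneg (q - 1 / 2),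
      mul_nonneg (sq_nonneg (q - 1 / 2)) h0]
  refine le_of_mul_le_mul_right ?_ (pow_pos h2 2)
  rw [e, pow_two (1 - q), ← mul_assoc, hk]
  norm_num
  linarith

theorem mul_kernelBound_le {r s : ℝ} (hs : 0 < s) (hqs : s ^ 2 * (1 - r ^ 2) = 2) :
    r * kernelBound (r ^ 2) ≤ 0.705 * s := by
  have h1 : r ^ 2 < 1 := by
    by_contra h
    nlinarith [sq_nonneg s]
  have hk := kernelBound_pow_four (sq_nonneg r) h1
  have hC := kernelBound_pos (sq_nonneg r) h1
  refine le_of_pow_le_pow_left₀ (n := 4) (by norm_num) (by positivity) ?_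
  have h2 : 0 < 1 - r ^ 2 := by linarith
  have e : (0.705 * s) ^ 4 * (1 - r ^ 2) ^ 2 = 0.705 ^ 4 * 4 := by
    rw [mul_pow, mul_assoc, show s ^ 4 * (1 - r ^ 2) ^ 2 = (s ^ 2 * (1 - r ^ 2)) ^ 2 by ring, hqs]
    norm_num
  refine le_of_mul_le_mul_right ?_ (pow_pos h2 2)
  have e2 : (r * kernelBound (r ^ 2)) ^ 4 * (1 - r ^ 2) ^ 2 =
      (r ^ 2) ^ 2 * (1 + r ^ 2) ^ 3 * (1 - r ^ 2) := by
    rw [mul_assoc, ← hk]; ring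
  rw [e, e2]
  have hq := sq_nonneg r
  generalize r ^ 2 = q at *
  norm_num
  have hp : ∀ a b : ℝ, 0.5 ≤ a → a ≤ q → (1 + a) ^ 3 * (1 - a) ≤ b →
      (1 + q) ^ 3 * (1 - q) ≤ b := by
    intro a b ha hq hb
    refine le_trans ?_ hb
    have : (1 + a) ^ 3 * (1 - a) - (1 + q) ^ 3 * (1 - q) =
        (q - a) * (q ^ 3 + q ^ 2 * a + q * a ^ 2 + a ^ 3 + 2 * (q ^ 2 + q * a + a ^ 2) - 2) := by
      ring
    have : 0 ≤ q ^ 3 + q ^ 2 * a + q * a ^ 2 + a ^ 3 + 2 * (q ^ 2 + q * a + a ^ 2) - 2 := by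
      have b1 : 0.25 ≤ q * a := by nlinarith
      have b2 : 0.25 ≤ q ^ 2 := by nlinarith
      have b3 : 0.25 ≤ a ^ 2 := by nlinarith
      nlinarith
    nlinarith [mul_nonneg (sub_nonneg.2 hq) this]
  have hsplit : ∀ b c : ℝ, 0 ≤ b → q ≤ b → (1 + q) ^ 3 * (1 - q) ≤ c →
      q ^ 2 * (1 + q) ^ 3 * (1 - q) ≤ b ^ 2 * c := by
    intro b c hb hqb hc
    rw [mul_assoc]
    have : 0 ≤ (1 + q) ^ 3 * (1 - q) := by positivity
    gcongr
  -- The target is `q² (1 + q)³ (1 - q) ≤ 4 · 0.705⁴`. On each piece `q²` is taken at the right end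
  -- and the rest at the left end, where it is largest since it decreases beyond `1/2`; on the first
  -- piece the rest has the global bound `27/16`.
  rcases le_total q 0.76 with h | h
  · have := hsplit 0.76 (27 / 16) (by norm_num) h (by
      nlinarith [mul_nonneg (sq_nonneg (q - 1 / 2)) (sq_nonneg q), sq_nonneg (q - 1 / 2),
        mul_nonneg (sq_nonneg (q - 1 / 2)) hq])
    linarith
  rcases le_total q 0.86 with h' | h'
  · have := hsplit 0.86 1.309 (by norm_num) h' (hp 0.76 _ (by norm_num) h (by norm_num))
    linarith
  · have := hsplit 1 0.902 (by norm_num) h1.le (hp 0.86 _ (by norm_num) h' (by norm_num))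
    linarith

/-- The induction step, divided by the new power of `s`, asks for `0.76 + u / s ≤ √(u² + 1)` with `u
= √(d + 1)`. For `s` near `√2` this fails at `u = √2` and holds from `√3` on, so `d = 0, 1, 2` are
done by hand. -/
theorem mul_geom_sum_le_of_sqrt_two_le {κ s : ℝ} (hκ : κ ≤ 0.76) (hs : 1.4142 ≤ s)
    (d : ℕ) : κ * ∑ i ∈ Finset.range (d + 1), s ^ i ≤ √((d : ℝ) + 1) * s ^ d := by
  have h2 : (1.4142 : ℝ) ≤ √2 := Real.le_sqrt_of_sq_le (by norm_num)
  have h3 : (1.732 : ℝ) ≤ √3 := Real.le_sqrt_of_sq_le (by norm_num)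
  have hmono : ∀ {a : ℝ}, 0 ≤ a → κ * a ≤ 0.76 * a := fun ha =>
    mul_le_mul_of_nonneg_right hκ ha
  rcases d with _ | _ | d
  · simp; linarith
  · norm_num [Finset.sum_range_succ]
    have := hmono (a := 1 + s) (by linarith)
    nlinarith
  · induction d with
    | zero =>
      norm_num [Finset.sum_range_succ]
      have := hmono (a := 1 + s + s ^ 2) (by positivity)
      nlinarith [sq_nonneg s]
    | succ d ih =>
      rw [Finset.sum_range_succ, mul_add]
      have hu : 0 ≤ √((((d + 2 : ℕ) : ℕ) : ℝ) + 1) := Real.sqrt_nonneg _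
      have hu3 : 1.732 ≤ √(((d + 2 : ℕ) : ℝ) + 1) :=
        h3.trans (Real.sqrt_le_sqrt (by push_cast; linarith [Nat.cast_nonneg (α := ℝ) d]))
      have hus := Real.sq_sqrt (x := ((d + 2 : ℕ) : ℝ) + 1) (by positivity)
      have hstep : 0.76 + √(((d + 2 : ℕ) : ℝ) + 1) * 0.70715 ≤ √(((d + 1 + 2 : ℕ) : ℝ) + 1) := by
        apply Real.le_sqrt_of_sq_le
        have e : ((d + 1 + 2 : ℕ) : ℝ) + 1 = √(((d + 2 : ℕ) : ℝ) + 1) ^ 2 + 1 := by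
          rw [hus]; push_cast; ring
        rw [e]
        generalize √(((d + 2 : ℕ) : ℝ) + 1) = u at *
        nlinarith
      have hp : 0 ≤ s ^ (d + 2) := by positivity
      have hs' : 1 ≤ 0.70715 * s := by linarith
      calc κ * ∑ i ∈ Finset.range (d + 1 + 1 + 1), s ^ i + κ * s ^ (d + 1 + 1 + 1)
          ≤ √(((d + 2 : ℕ) : ℝ) + 1) * s ^ (d + 2) * (0.70715 * s) +
              0.76 * s ^ (d + 1 + 1 + 1) := by
            refine add_le_add (ih.trans ?_) (hmono (by positivity))
            exact le_mul_of_one_le_right (by positivity) hs'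
        _ = (0.76 + √(((d + 2 : ℕ) : ℝ) + 1) * 0.70715) * s ^ (d + 1 + 2) := by ring
        _ ≤ _ := mul_le_mul_of_nonneg_right hstep (by positivity)

theorem mul_geom_sum_le_of_two_le {κ s : ℝ} (hκ : κ ≤ 0.94) (hs : 2 ≤ s)
    (d : ℕ) : κ * ∑ i ∈ Finset.range (d + 1), s ^ i ≤ √((d : ℝ) + 1) * s ^ d := by
  have h2 : (1.4142 : ℝ) ≤ √2 := Real.le_sqrt_of_sq_le (by norm_num)
  have hmono : ∀ {a : ℝ}, 0 ≤ a → κ * a ≤ 0.94 * a := fun ha =>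
    mul_le_mul_of_nonneg_right hκ ha
  rcases d with _ | d
  · simp; linarith
  · induction d with
    | zero =>
      norm_num [Finset.sum_range_succ]
      have := hmono (a := 1 + s) (by positivity)
      nlinarith [sq_nonneg s]
    | succ d ih =>
      rw [Finset.sum_range_succ, mul_add]
      have hu2 : 1.4142 ≤ √(((d + 1 : ℕ) : ℝ) + 1) :=
        h2.trans (Real.sqrt_le_sqrt (by push_cast; linarith [Nat.cast_nonneg (α := ℝ) d]))
      have hus := Real.sq_sqrt (x := ((d + 1 : ℕ) : ℝ) + 1) (by positivity)
      have hstep : 0.94 + √(((d + 1 : ℕ) : ℝ) + 1) * (1 / 2) ≤ √(((d + 1 + 1 : ℕ) : ℝ) + 1) := by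
        apply Real.le_sqrt_of_sq_le
        have e : ((d + 1 + 1 : ℕ) : ℝ) + 1 = √(((d + 1 : ℕ) : ℝ) + 1) ^ 2 + 1 := by
          rw [hus]; push_cast; ring
        rw [e]
        generalize √(((d + 1 : ℕ) : ℝ) + 1) = u at *
        nlinarith
      have hs' : 1 ≤ 1 / 2 * s := by linarith
      calc κ * ∑ i ∈ Finset.range (d + 1 + 1), s ^ i + κ * s ^ (d + 1 + 1)
          ≤ √(((d + 1 : ℕ) : ℝ) + 1) * s ^ (d + 1) * (1 / 2 * s) + 0.94 * s ^ (d + 1 + 1) := by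
            refine add_le_add (ih.trans ?_) (hmono (by positivity))
            exact le_mul_of_one_le_right (by positivity) hs'
        _ = (0.94 + √(((d + 1 : ℕ) : ℝ) + 1) * (1 / 2)) * s ^ (d + 1 + 1) := by ring
        _ ≤ _ := mul_le_mul_of_nonneg_right hstep (by positivity)


section Comparison


variable {m : ℕ} {r s : ℝ}

theorem one_le_lebesgueBound (m : ℕ) : 1 ≤ lebesgueBound m := by
  have : 0 ≤ Real.log ((m : ℝ) + 1) := Real.log_nonneg (by linarith [Nat.cast_nonneg (α := ℝ) m])
  have := Real.pi_pos
  unfold lebesgueBound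
  have : 0 ≤ 2 / Real.pi * Real.log ((m : ℝ) + 1) := by positivity
  linarith

theorem lebesgueBound_le_mul (m : ℕ) {b : ℝ} (h : Real.log ((m : ℝ) + 1) ≤ b) :
    lebesgueBound m ≤ 0.6367 * b + 1 := by
  have : 0 ≤ Real.log ((m : ℝ) + 1) := Real.log_nonneg (by linarith [Nat.cast_nonneg (α := ℝ) m])
  have := mul_le_mul two_div_pi_le h this (by norm_num)
  unfold lebesgueBound
  linarith

theorem sq_lt_one_of_sq_mul (hqs : s ^ 2 * (1 - r ^ 2) = 2) : r ^ 2 < 1 := by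
  by_contra h
  nlinarith [sq_nonneg s]

/-- Since `(1 + r²) / (1 - r²) = s² - 1`, a lower bound on `r ^ (2 (m + 1))` limits the number of
nodes by a multiple of `s² - 1`. -/
theorem succ_le_log_mul {c : ℝ} (h0 : 0 < r) (hqs : s ^ 2 * (1 - r ^ 2) = 2) (hc : 0 < c)
    (hy : c ≤ (r ^ 2) ^ (m + 1)) : (m : ℝ) + 1 ≤ Real.log c⁻¹ / 2 * (s ^ 2 - 1) := by
  have h1 := sq_lt_one_of_sq_mul hqs
  have h := mul_le_log_inv_of_le_pow (by positivity) h1 hc hy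
  have hq : 1 + r ^ 2 = (1 - r ^ 2) * (s ^ 2 - 1) := by linarith
  have h2 : 0 < s ^ 2 - 1 := by
    refine pos_of_mul_pos_right (a := 1 - r ^ 2) ?_ (by linarith)
    rw [← hq]; positivity
  have e : 2 * (1 - r ^ 2) / (1 + r ^ 2) = 2 / (s ^ 2 - 1) := by
    have : 1 - r ^ 2 ≠ 0 := by linarith
    rw [hq]
    field_simp
  rw [e, ← mul_div_assoc, div_le_iff₀ h2] at h
  push_cast at h
  linarith

theorem le_of_sq_mul_le {c : ℝ} (hs : 0 < s) (hqs : s ^ 2 * (1 - r ^ 2) = 2)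
    (h : c ^ 2 * (1 - r ^ 2) ≤ 2) : c ≤ s := by
  have h1 := sq_lt_one_of_sq_mul hqs
  refine le_of_sq_le_sq ?_ hs.le
  rw [← hqs] at h
  exact le_of_mul_le_mul_right h (by linarith)

/-- With `m ≥ 1` the assumption forces `r² ≥ 1/2`, so `s ≥ 2`, and leaves at most `log 2 · (s² - 1)`
nodes. Hence `1 + Λ ≤ s + 1/s`, `Λ` being the Lebesgue bound, and `(s + 1/s)² r² ≤ s² ≤ 4 s² r^(2 (m
+ 1))`. -/
theorem one_add_lebesgueBound_le (h0 : 0 < r) (hs : 0 < s) (hqs : s ^ 2 * (1 - r ^ 2) = 2)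
    (hm : 1 ≤ m) (hy : 1 / 4 ≤ (r ^ 2) ^ (m + 1)) :
    2 ≤ s ∧ lebesgueBound m ≤ s ∧ 1 + lebesgueBound m ≤ 2 * s * r ^ m := by
  have h1 := sq_lt_one_of_sq_mul hqs
  have hq : 1 / 2 ≤ r ^ 2 := by
    have : (r ^ 2) ^ (m + 1) ≤ (r ^ 2) ^ 2 :=
      pow_le_pow_of_le_one (by positivity) h1.le (by omega)
    nlinarith [sq_nonneg r]
  have h2 : 2 ≤ s := le_of_sq_mul_le hs hqs (by nlinarith)
  have hlog2 := Real.log_two_lt_d9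
  have hN := succ_le_log_mul h0 hqs (by norm_num) hy
  have hlog4 : Real.log (1 / 4)⁻¹ = 2 * Real.log 2 := by
    rw [show ((1 : ℝ) / 4)⁻¹ = 2 ^ 2 by norm_num, Real.log_pow]; norm_num
  rw [hlog4] at hN
  have hs4 : 0 ≤ s ^ 2 - 1 := by nlinarith
  -- The value of `b` is `3/2 · log 2` rounded up, so that `a b / 3` covers the factor `log 2` of
  -- `hN`.
  have hL := lebesgueBound_le_mul m (log_le_of_le_mul (n := (m : ℝ) + 1) (s := s) (a := 2)
    (b := 1.03973) (by positivity) (by linarith) (by norm_num) (by norm_num)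
    (by nlinarith [mul_nonneg (sub_nonneg.2 hlog2.le) hs4]))
  refine ⟨h2, by linarith, ?_⟩
  have hL2 : 1 + lebesgueBound m ≤ s + s⁻¹ := by
    have : s * s⁻¹ = 1 := mul_inv_cancel₀ hs.ne'
    have : 0 < s⁻¹ := inv_pos.2 hs
    have : 0.7773 ≤ 0.15106 * s + s⁻¹ := by
      have h3 : 0 ≤ (0.15106 * s - s⁻¹) ^ 2 := sq_nonneg _
      refine le_of_sq_le_sq ?_ (by positivity)
      nlinarith
    linarith
  refine hL2.trans ?_
  refine le_of_sq_le_sq ?_ (by positivity)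
  have hr2 : 0 < r ^ 2 := by positivity
  refine le_of_mul_le_mul_right ?_ hr2
  have e1 : (2 * s * r ^ m) ^ 2 * r ^ 2 = 4 * s ^ 2 * (r ^ 2) ^ (m + 1) := by ring
  have e2 : (s + s⁻¹) ^ 2 * r ^ 2 ≤ s ^ 2 := by
    have e3 : r ^ 2 = 1 - 2 * (s⁻¹) ^ 2 := by
      field_simp
      linarith
    have e4 : s * s⁻¹ = 1 := mul_inv_cancel₀ hs.ne'
    have : (s + s⁻¹) ^ 2 * (1 - 2 * (s⁻¹) ^ 2) =
        s ^ 2 + 2 * (s * s⁻¹) - 2 * (s * s⁻¹) ^ 2 - 4 * (s * s⁻¹) * s⁻¹ ^ 2 + s⁻¹ ^ 2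
          - 2 * (s⁻¹ ^ 2) ^ 2 := by ring
    rw [e3, this, e4]
    nlinarith [sq_nonneg (s⁻¹), sq_nonneg (s⁻¹ ^ 2)]
  rw [e1]
  nlinarith [sq_nonneg s]

theorem lebesgueBound_le_of_two_le (h0 : 0 < r) (hs : 2 ≤ s) (hqs : s ^ 2 * (1 - r ^ 2) = 2)
    (hy : 1 / 16 ≤ (r ^ 2) ^ (m + 1)) :
    lebesgueBound m ≤ s := by
  have hlog2 := Real.log_two_lt_d9
  have hN := succ_le_log_mul h0 hqs (by norm_num) hy
  have hlog4 : Real.log (1 / 16)⁻¹ = 4 * Real.log 2 := by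
    rw [show ((1 : ℝ) / 16)⁻¹ = 2 ^ 4 by norm_num, Real.log_pow]; norm_num
  have hlog4' : Real.log 4 = 2 * Real.log 2 := by
    rw [show (4 : ℝ) = 2 ^ 2 by norm_num, Real.log_pow]; norm_num
  rw [hlog4] at hN
  have hs4 : 0 ≤ s ^ 2 - 1 := by nlinarith
  have hL := lebesgueBound_le_mul m (log_le_of_le_mul (n := (m : ℝ) + 1) (s := s) (a := 4)
    (b := 1.03973) (by positivity) (by linarith) (by norm_num) (by norm_num)
    (by nlinarith [mul_nonneg (sub_nonneg.2 hlog2.le) hs4]))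
  linarith

theorem errBound_eq_mul_sqrt (h0 : 0 < r) : errBound (m + 1) r =
    2 * √((r ^ 2) ^ (m + 1)) / (1 - (r ^ 2) ^ (m + 1)) * kernelBound (r ^ 2) := by
  have e : √((r ^ 2) ^ (m + 1)) = r ^ (m + 1) := by
    rw [← pow_mul, mul_comm 2, pow_mul, Real.sqrt_sq (by positivity)]
  rw [errBound, e]

/-- Here `errBound` is at most a constant times `s`: about `0.2894 s` in the first case, where `s ≥
√2` suffices, and about `0.4299 s` in the second, which is where `1.754` comes from. -/
theorem one_add_errBound_le (h0 : 0 < r) (hs : 0 < s) (hqs : s ^ 2 * (1 - r ^ 2) = 2)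
    (hy : (r ^ 2) ^ (m + 1) ≤ 1 / 33 ∨ (r ^ 2) ^ (m + 1) ≤ 1 / 16 ∧ 1.754 ≤ s) :
    1 + errBound (m + 1) r ≤ s := by
  have hs2 : 1.4142 ≤ s := le_of_sq_mul_le hs hqs (by nlinarith [sq_nonneg r])
  have hk := kernelBound_le (sq_nonneg r) hs hqs
  have h1 := sq_lt_one_of_sq_mul hqs
  have hk0 := kernelBound_pos (sq_nonneg r) h1
  rw [errBound_eq_mul_sqrt h0]
  have hy0 : 0 ≤ (r ^ 2) ^ (m + 1) := by positivity
  generalize (r ^ 2) ^ (m + 1) = y at *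
  have key : ∀ a b c : ℝ, 0 < a → a < 1 → 0 ≤ b → a ≤ b ^ 2 → y ≤ a → 2 * b / (1 - a) ≤ c →
      2 * √y / (1 - y) * kernelBound (r ^ 2) ≤ c * (0.806 * s) := by
    intro a b c ha ha1 hb hab hya hc
    have : √y ≤ b := Real.sqrt_le_left hb |>.2 (hya.trans hab)
    have h1a : 0 < 1 - a := by linarith
    have : 2 * √y / (1 - y) ≤ 2 * b / (1 - a) := by gcongr
    have h3 : 0 ≤ 2 * b / (1 - a) := by positivity
    have hc0 := h3.trans hc
    exact mul_le_mul (this.trans hc) hk hk0.le hc0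
  rcases hy with hy | ⟨hy, hs3⟩
  · have := key (1 / 33) 0.17408 0.35904 (by norm_num) (by norm_num) (by norm_num) (by norm_num) hy
      (by norm_num)
    linarith
  · have := key (1 / 16) 0.25 0.53334 (by norm_num) (by norm_num) (by norm_num) (by norm_num) hy
      (by norm_num)
    linarith

/-- Let `y = r ^ (2 (m + 1))`. A small `y` makes the interpolation error small, so `1 + errBound`
works; a larger `y` puts `r` near `1` relative to `m`, so `s` is large and the Lebesgue bound works.
The cases `m = 1, 2` with `y ≥ 1/33` are checked numerically. -/
theorem exists_growth_le (h0 : 0 < r) (hs : 0 < s) (hqs : s ^ 2 * (1 - r ^ 2) = 2)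
    (hm : 1 ≤ m) :
    ∃ lam, (lam = lebesgueBound m ∨ lam = 1 + errBound (m + 1) r) ∧ lam ≤ s := by
  have h1 := sq_lt_one_of_sq_mul hqs
  have hq := sq_nonneg r
  rcases le_total ((r ^ 2) ^ (m + 1)) (1 / 33) with hy | hy
  · exact ⟨_, Or.inr rfl, one_add_errBound_le h0 hs hqs (Or.inl hy)⟩
  have hlog2 := Real.log_two_lt_d9
  rcases Nat.lt_or_ge m 3 with h3 | h3
  · refine ⟨_, Or.inl rfl, ?_⟩
    interval_cases m
    · have hs2 : 1.5 ≤ s := by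
        norm_num at hy
        have : 0.17 ≤ r ^ 2 := by
          refine le_of_sq_le_sq ?_ hq
          linarith
        exact le_of_sq_mul_le hs hqs (by nlinarith)
      have := lebesgueBound_le_mul 1 (b := 0.7) (by norm_num; linarith)
      linarith
    · have hs2 : 1.704 ≤ s := by
        norm_num at hy
        have : 0.3116 ≤ r ^ 2 := by
          refine le_of_pow_le_pow_left₀ (n := 3) (by norm_num) hq ?_
          linarith
        exact le_of_sq_mul_le hs hqs (by nlinarith)
      have hlog3 : Real.log 3 ≤ 1.1023 := by
        have e : 2 * Real.log 3 = 3 * Real.log 2 + Real.log (9 / 8) := by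
          rw [show (9 : ℝ) / 8 = 3 ^ 2 / 2 ^ 3 by norm_num,
            Real.log_div (by norm_num) (by norm_num), Real.log_pow, Real.log_pow]
          push_cast
          ring
        have := Real.log_le_sub_one_of_pos (x := 9 / 8) (by norm_num)
        linarith
      have := lebesgueBound_le_mul 2 (b := 1.1023) (by norm_num at hlog3 ⊢; linarith)
      linarith
  · have hy4 : (r ^ 2) ^ (m + 1) ≤ (r ^ 2) ^ 4 := pow_le_pow_of_le_one hq h1.le (by omega)
    rcases le_total ((r ^ 2) ^ (m + 1)) (1 / 16) with hy' | hy'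
    · refine ⟨_, Or.inr rfl, one_add_errBound_le h0 hs hqs (Or.inr ⟨hy', ?_⟩)⟩
      have : 0.39 ≤ r ^ 2 := by
        refine le_of_pow_le_pow_left₀ (n := 4) (by norm_num) hq ?_
        linarith
      exact le_of_sq_mul_le hs hqs (by nlinarith)
    · refine ⟨_, Or.inl rfl, lebesgueBound_le_of_two_le h0 ?_ hqs hy'⟩
      have : 1 / 2 ≤ r ^ 2 := by
        refine le_of_pow_le_pow_left₀ (n := 4) (by norm_num) hq ?_
        linarith
      exact le_of_sq_mul_le hs hqs (by nlinarith)

theorem errBound_mul_geom_sum_le (h0 : 0 < r) (hs : 0 < s) (hqs : s ^ 2 * (1 - r ^ 2) = 2)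
    (hy : (r ^ 2) ^ (m + 1) ≤ 1 / 4) (d : ℕ) :
    errBound (m + 1) r * ∑ i ∈ Finset.range (d + 1), s ^ i ≤
      2 * √((d : ℝ) + 1) * s ^ (d + 1) * r ^ m := by
  have h1 := sq_lt_one_of_sq_mul hqs
  have hk0 := kernelBound_pos (sq_nonneg r) h1
  have hs2 : 1.4142 ≤ s := le_of_sq_mul_le hs hqs (by nlinarith [sq_nonneg r])
  have hy0 : 0 ≤ (r ^ 2) ^ (m + 1) := by positivity
  -- `κ` is what remains of `errBound` once the target's factor `2 s r^m` is removed. As `1 / (1 -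
  -- y) ≤ 4/3`, it is at most `0.76` for `r² ≤ 1/2`, and at most `0.94` otherwise, where `s ≥ 2`.
  obtain ⟨κ, hκ⟩ : ∃ κ, κ = r * kernelBound (r ^ 2) / (s * (1 - (r ^ 2) ^ (m + 1))) := ⟨_, rfl⟩
  have hy1 : 0 < 1 - (r ^ 2) ^ (m + 1) := by linarith
  have he : errBound (m + 1) r = 2 * s * r ^ m * κ := by
    rw [hκ, errBound]
    field_simp
    ring
  have hbd : ∀ a : ℝ, 0 ≤ a → r * kernelBound (r ^ 2) ≤ a * s → κ ≤ 4 / 3 * a := by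
    intro a ha hak
    rw [hκ, div_le_iff₀ (by positivity)]
    nlinarith [mul_nonneg ha hs.le]
  have hsum : κ * ∑ i ∈ Finset.range (d + 1), s ^ i ≤ √((d : ℝ) + 1) * s ^ d := by
    rcases le_total (r ^ 2) (1 / 2) with hq | hq
    · refine mul_geom_sum_le_of_sqrt_two_le ?_ hs2 d
      have hr : r ≤ 0.70711 := le_of_sq_le_sq (by linarith) (by norm_num)
      have := mul_le_mul hr (kernelBound_le (sq_nonneg r) hs hqs) hk0.le (by norm_num)
      have := hbd 0.57 (by norm_num) (by linarith)
      linarith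
    · refine mul_geom_sum_le_of_two_le ?_ (le_of_sq_mul_le hs hqs (by nlinarith)) d
      have := hbd 0.705 (by norm_num) (mul_kernelBound_le hs hqs)
      linarith
  calc errBound (m + 1) r * ∑ i ∈ Finset.range (d + 1), s ^ i
      = 2 * s * r ^ m * (κ * ∑ i ∈ Finset.range (d + 1), s ^ i) := by rw [he]; ring
    _ ≤ 2 * s * r ^ m * (√((d : ℝ) + 1) * s ^ d) := by gcongr
    _ = _ := by ring

end Comparison

theorem Box.abs_sub_chebInterp_le_mul {d : ℕ} (D : Box d) {ρ B : ℝ} {g : D.toSet → ℝ} {m : ℕ}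
    {r s : ℝ} (h : HasBoundedAnalyticExtension D ρ B g) (hρ : 1 < ρ) (hd : 0 < d) (hm : 1 ≤ m)
    (h0 : ρ⁻¹ < r) (h1 : r < 1) (hs : 0 < s) (hqs : s ^ 2 * (1 - r ^ 2) = 2) (x : D.toSet) :
    |g x - D.chebInterp m (fun j => g ⟨D.node m j, D.node_mem m j⟩) x| ≤
      B * (2 * √(d : ℝ) * s ^ d * r ^ m) := by
  have hr : 0 < r := (inv_pos.2 (by linarith)).trans h0
  have hB := D.bound_nonneg hρ h
  obtain ⟨d, rfl⟩ : ∃ k, d = k + 1 := ⟨d - 1, by omega⟩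
  rcases le_total ((r ^ 2) ^ (m + 1)) (1 / 4) with hy | hy
  · obtain ⟨lam, hlam, hle⟩ := exists_growth_le hr hs hqs hm
    refine (D.abs_sub_chebInterp_le h hρ m h0 h1 hlam x).trans
      (mul_le_mul_of_nonneg_left ?_ hB)
    have := errBound_mul_geom_sum_le hr hs hqs hy d
    push_cast
    refine le_trans ?_ this
    have he : 0 ≤ errBound (m + 1) r := by
      have : (r ^ 2) ^ (m + 1) < 1 := by linarith
      have : 0 < 1 - (r ^ 2) ^ (m + 1) := by linarith
      have := kernelBound_pos (sq_nonneg r) (by nlinarith)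
      unfold errBound
      positivity
    have hl : 0 ≤ lam := by
      rcases hlam with rfl | rfl
      · exact (zero_le_one.trans (one_le_lebesgueBound m))
      · linarith
    gcongr
  · obtain ⟨h2, hl, hl'⟩ := one_add_lebesgueBound_le hr hs hqs hm hy
    refine (D.abs_sub_chebInterp_le_one_add h hρ m x).trans (mul_le_mul_of_nonneg_left ?_ hB)
    have hL := one_le_lebesgueBound m
    have hd1 : 1 ≤ √((d + 1 : ℕ) : ℝ) :=
      Real.one_le_sqrt.2 (by push_cast; linarith [Nat.cast_nonneg (α := ℝ) d])
    calc 1 + lebesgueBound m ^ (d + 1) ≤ s ^ d + s ^ d * lebesgueBound m := by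
          rw [pow_succ]
          gcongr
          exact one_le_pow₀ (by linarith)
      _ = s ^ d * (1 + lebesgueBound m) := by ring
      _ ≤ s ^ d * (2 * s * r ^ m) := by gcongr
      _ = 1 * (2 * s ^ (d + 1) * r ^ m) := by ring
      _ ≤ √((d + 1 : ℕ) : ℝ) * (2 * s ^ (d + 1) * r ^ m) := by gcongr
      _ = _ := by ring

/-- The extension is controlled only on the open ellipse, so the contour bound holds for `r > 1/ρ`;
its right side is continuous in `r` and equals `epsInt` at `1/ρ`. -/
theorem Box.abs_sub_chebInterp_le_epsInt {d : ℕ} (D : Box d) {ρ B : ℝ} {g : D.toSet → ℝ} {m : ℕ}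
    (h : HasBoundedAnalyticExtension D ρ B g) (hρ : 1 < ρ) (hd : 0 < d) (hm : 1 ≤ m)
    (x : D.toSet) :
    |g x - D.chebInterp m (fun j => g ⟨D.node m j, D.node_mem m j⟩) x| ≤ epsInt ρ d m B := by
  have hρ0 : 0 < ρ := by linarith
  have hi1 : ρ⁻¹ < 1 := inv_lt_one_of_one_lt₀ hρ
  have hi0 : 0 < ρ⁻¹ := inv_pos.2 hρ0
  have hcont : ContinuousAt (fun r : ℝ => B * (2 * √(d : ℝ) * √(2 / (1 - r ^ 2)) ^ d * r ^ m))
      ρ⁻¹ := by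
    have : 1 - ρ⁻¹ ^ 2 ≠ 0 := by nlinarith
    fun_prop (disch := assumption)
  have heq : B * (2 * √(d : ℝ) * √(2 / (1 - ρ⁻¹ ^ 2)) ^ d * ρ⁻¹ ^ m) = epsInt ρ d m B := by
    have hp : 0 < 1 - (ρ ^ 2)⁻¹ := by
      rw [← inv_pow]; nlinarith
    have hpow : √(2 / (1 - (ρ ^ 2)⁻¹)) ^ d = (2 / (1 - (ρ ^ 2)⁻¹)) ^ ((d : ℝ) / 2) := by
      rw [Real.sqrt_eq_rpow, ← Real.rpow_mul_natCast (by positivity),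
        show (1 / 2 : ℝ) * d = d / 2 by ring]
    unfold epsInt
    rw [inv_pow, inv_pow, hpow, Real.div_rpow (by norm_num) hp.le, Real.rpow_add (by norm_num),
      Real.rpow_neg hp.le,
      Real.rpow_one]
    ring
  rw [← heq]
  refine ge_of_tendsto (hcont.tendsto.mono_left (nhdsWithin_le_nhds (s := Set.Ioi ρ⁻¹))) ?_
  filter_upwards [Ioo_mem_nhdsGT hi1] with r hr
  have hr0 : 0 < r := hi0.trans hr.1
  have hp : 0 < 1 - r ^ 2 := by nlinarith [hr.2]
  refine D.abs_sub_chebInterp_le_mul h hρ hd hm hr.1 hr.2 (Real.sqrt_pos.2 (by positivity)) ?_ x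
  rw [Real.sq_sqrt (by positivity)]
  field_simp

/-! ### Random variables with finite support -/

section FiniteSupport

variable {Ω E : Type*} {mΩ : MeasurableSpace Ω} {μ : Measure Ω} {X : Ω → E} {A : Finset E}

/-- With finite support every function of `X` is a finite sum of indicators. This is why the later
integrals need no measurability of `φ`. -/
theorem comp_ae_eq_sum_indicator (hA : ∀ᵐ ω ∂μ, X ω ∈ A) (φ : E → ℝ) :
    (fun ω => φ (X ω)) =ᵐ[μ] fun ω => ∑ a ∈ A, φ a * (X ⁻¹' {a}).indicator (fun _ => 1) ω := by
  classical
  filter_upwards [hA] with ω hω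
  simp [Set.indicator_apply, hω]

variable [MeasurableSpace E] [MeasurableSingletonClass E]

theorem integrable_comp_of_mem_finset [IsFiniteMeasure μ] (hX : Measurable X)
    (hA : ∀ᵐ ω ∂μ, X ω ∈ A) (φ : E → ℝ) : Integrable (fun ω => φ (X ω)) μ := by
  refine Integrable.congr ?_ (comp_ae_eq_sum_indicator hA φ).symm
  exact integrable_finsetSum _ fun a _ =>
    ((integrable_const _).indicator (hX (measurableSet_singleton a))).const_mul _

theorem setIntegral_comp_of_mem_finset [IsFiniteMeasure μ] (hX : Measurable X)
    (hA : ∀ᵐ ω ∂μ, X ω ∈ A) (φ : E → ℝ) (B : Set Ω) :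
    ∫ ω in B, φ (X ω) ∂μ =
      ∑ a ∈ A, φ a * ∫ ω in B, (X ⁻¹' {a}).indicator (fun _ => (1 : ℝ)) ω ∂μ := by
  rw [integral_congr_ae (ae_restrict_of_ae (comp_ae_eq_sum_indicator hA φ)), integral_finsetSum]
  · exact Finset.sum_congr rfl fun a _ => integral_const_mul _ _
  · exact fun a _ => (((integrable_const _).indicator
      (hX (measurableSet_singleton a))).const_mul _).integrableOn

theorem integral_eq_sum_of_mem_finset {ν : Measure E} [IsFiniteMeasure ν]
    (hA : ν ((A : Set E)ᶜ) = 0) (φ : E → ℝ) : ∫ x, φ x ∂ν = ∑ a ∈ A, φ a * ν.real {a} := by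
  have h := setIntegral_comp_of_mem_finset (μ := ν) (X := id) measurable_id
    (A := A) (by rw [ae_iff]; exact hA) φ Set.univ
  simp only [Measure.restrict_univ, id_eq, Set.preimage_id] at h
  rw [h]
  refine Finset.sum_congr rfl fun a _ => ?_
  rw [integral_indicator_const _ (measurableSet_singleton a)]
  simp

end FiniteSupport

/-! ### Dynamic programming for the optimal stopping problem -/

namespace Market

variable {d K : ℕ} (M : Market d K)

/-- From date `k` on, `S` is a Markov process with the transition laws of `M`, and it starts from
finitely many points. -/
structure IsMarkovFrom {Ω : Type*} {mΩ : MeasurableSpace Ω} (μ : Measure Ω)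
    (ℱ : Filtration ℕ mΩ) (S : ℕ → Ω → M.space) (k : ℕ) : Prop where
  adapted : ∀ n, k ≤ n → n ≤ K → Measurable[ℱ n] (S n)
  start : ∃ A : Finset M.space, ∀ᵐ ω ∂μ, S k ω ∈ A
  markov_property : ∀ n, k ≤ n → n < K → ∀ A : Set M.space, MeasurableSet A →
    μ[(S (n + 1) ⁻¹' A).indicator (fun _ => (1 : ℝ)) | ℱ n] =ᵐ[μ]
      fun ω => (M.step n (S n ω)).real A

/-- The dynamic programming value with `j` exercise dates to go after the present one. -/
def bellman : ℕ → M.space → ℝ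
  | 0 => M.payoff K
  | j + 1 => fun s => max (M.payoff (K - (j + 1)) s) (∫ s', bellman j s' ∂(M.step (K - (j + 1)) s))

/-- The dynamic programming value at date `n`. -/
def dpValue (n : ℕ) : M.space → ℝ := M.bellman (K - n)

theorem dpValue_last : M.dpValue K = M.payoff K := by
  simp [dpValue, bellman]

theorem dpValue_of_lt {n : ℕ} (hn : n < K) (s : M.space) :
    M.dpValue n s = max (M.payoff n s) (∫ s', M.dpValue (n + 1) s' ∂(M.step n s)) := by
  obtain ⟨j, rfl⟩ : ∃ j, K = n + (j + 1) := ⟨K - n - 1, by omega⟩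
  simp only [dpValue]
  rw [show n + (j + 1) - n = j + 1 by omega, bellman,
    show n + (j + 1) - (j + 1) = n by omega, show n + (j + 1) - (n + 1) = j by omega]

theorem payoff_le_dpValue {n : ℕ} (hn : n ≤ K) (s : M.space) : M.payoff n s ≤ M.dpValue n s := by
  rcases hn.lt_or_eq with h | rfl
  · exact (M.dpValue_of_lt h s).symm ▸ le_max_left _ _
  · rw [M.dpValue_last]

namespace IsMarkovFrom

variable {M} {Ω : Type*} {mΩ : MeasurableSpace Ω} {μ : Measure Ω} {ℱ : Filtration ℕ mΩ}
  {S : ℕ → Ω → M.space} {k : ℕ}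

theorem measurable (h : M.IsMarkovFrom μ ℱ S k) {n : ℕ} (hk : k ≤ n) (hn : n ≤ K) :
    Measurable (S n) :=
  (h.adapted n hk hn).mono (ℱ.le n) le_rfl

variable [IsProbabilityMeasure μ]

theorem ae_mem_succ (h : M.IsMarkovFrom μ ℱ S k) {n : ℕ} (hk : k ≤ n) (hn : n < K)
    {A A' : Finset M.space} (hA : ∀ᵐ ω ∂μ, S n ω ∈ A)
    (hA' : ∀ s ∈ A, M.step n s ((A' : Set M.space)ᶜ) = 0) : ∀ᵐ ω ∂μ, S (n + 1) ω ∈ A' := by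
  have hms : MeasurableSet ((A' : Set M.space)ᶜ) := A'.measurableSet.compl
  have hm := h.measurable (n := n + 1) (by omega) hn
  have h1 := setIntegral_condExp (μ := μ) (ℱ.le n)
    (f := (S (n + 1) ⁻¹' ((A' : Set M.space)ᶜ)).indicator (fun _ => (1 : ℝ)))
    ((integrable_const _).indicator (hm hms)) MeasurableSet.univ
  rw [Measure.restrict_univ, integral_indicator_const _ (hm hms),
    integral_congr_ae (h.markov_property n hk hn _ hms)] at h1
  have h2 : ∫ ω, (M.step n (S n ω)).real ((A' : Set M.space)ᶜ) ∂μ = 0 := by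
    refine integral_eq_zero_of_ae ?_
    filter_upwards [hA] with ω hω
    simp [Measure.real, hA' _ hω]
  rw [h2] at h1
  have h3 : μ (S (n + 1) ⁻¹' ((A' : Set M.space)ᶜ)) = 0 := by
    simpa [measureReal_eq_zero_iff] using h1.symm
  rw [ae_iff]
  exact h3

theorem exists_support_succ (M : Market d K) {n : ℕ} (hn : n < K) (A : Finset M.space) :
    ∃ A' : Finset M.space, ∀ s ∈ A, M.step n s ((A' : Set M.space)ᶜ) = 0 := by
  classical
  choose T hT using M.finite_step n hn
  refine ⟨A.biUnion T, fun s hs => measure_mono_null (Set.compl_subset_compl.2 ?_) (hT s)⟩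
  exact_mod_cast Finset.subset_biUnion_of_mem T hs

theorem exists_support (h : M.IsMarkovFrom μ ℱ S k) {n : ℕ} (hk : k ≤ n) (hn : n ≤ K) :
    ∃ A : Finset M.space, ∀ᵐ ω ∂μ, S n ω ∈ A := by
  induction n, hk using Nat.le_induction with
  | base => exact h.start
  | succ n hk ih =>
    obtain ⟨A, hA⟩ := ih (by omega)
    obtain ⟨A', hA'⟩ := exists_support_succ M hn A
    exact ⟨A', h.ae_mem_succ hk hn hA hA'⟩

theorem of_le (h : M.IsMarkovFrom μ ℱ S k) {n : ℕ} (hk : k ≤ n) (hn : n ≤ K) :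
    M.IsMarkovFrom μ ℱ S n where
  adapted i hi := h.adapted i (hk.trans hi)
  start := h.exists_support hk hn
  markov_property i hi := h.markov_property i (hk.trans hi)

theorem integrable (h : M.IsMarkovFrom μ ℱ S k) {n : ℕ} (hk : k ≤ n) (hn : n ≤ K)
    (φ : M.space → ℝ) : Integrable (fun ω => φ (S n ω)) μ := by
  obtain ⟨A, hA⟩ := h.exists_support hk hn
  exact integrable_comp_of_mem_finset (h.measurable hk hn) hA φ

/-- The Markov property is assumed for indicators only; finite support reduces an arbitrary `φ` to
indicators of single points. -/
theorem setIntegral_succ (h : M.IsMarkovFrom μ ℱ S k) {n : ℕ} (hk : k ≤ n) (hn : n < K)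
    (φ : M.space → ℝ) {B : Set Ω} (hB : MeasurableSet[ℱ n] B) :
    ∫ ω in B, φ (S (n + 1) ω) ∂μ = ∫ ω in B, ∫ s, φ s ∂(M.step n (S n ω)) ∂μ := by
  obtain ⟨A, hA⟩ := h.exists_support hk hn.le
  obtain ⟨A', hA'⟩ := exists_support_succ M hn A
  have := M.markov n
  have hm := h.measurable (n := n + 1) (by omega) hn
  rw [setIntegral_comp_of_mem_finset hm (h.ae_mem_succ hk hn hA hA')]
  have h1 : ∀ᵐ ω ∂μ, ∫ s, φ s ∂(M.step n (S n ω)) =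
      ∑ a ∈ A', φ a * (M.step n (S n ω)).real {a} := by
    filter_upwards [hA] with ω hω
    exact integral_eq_sum_of_mem_finset (hA' _ hω) φ
  rw [integral_congr_ae (ae_restrict_of_ae h1), integral_finsetSum]
  · refine Finset.sum_congr rfl fun a _ => ?_
    rw [integral_const_mul, ← setIntegral_condExp (ℱ.le n) ((integrable_const _).indicator
      (hm (measurableSet_singleton a))) hB,
      integral_congr_ae (ae_restrict_of_ae (h.markov_property n hk hn {a}
        (measurableSet_singleton a)))]
  · exact fun a _ => ((h.integrable hk hn.le
      fun s => (M.step n s).real {a}).const_mul _).integrableOn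

section StoppingTime

variable {τ : Ω → ℕ}

theorem measurableSet_le_of_lt (hτ : IsStoppingTime ℱ (fun ω => (τ ω : WithTop ℕ))) (n : ℕ) :
    MeasurableSet[ℱ n] {ω | n + 1 ≤ τ ω} := by
  have := (hτ n).compl
  convert this using 1
  ext ω
  simp

theorem integrable_stopped (h : M.IsMarkovFrom μ ℱ S k)
    (hτ : IsStoppingTime ℱ (fun ω => (τ ω : WithTop ℕ))) (hb : ∀ ω, k ≤ τ ω ∧ τ ω ≤ K)
    (f : ℕ → M.space → ℝ) : Integrable (fun ω => f (τ ω) (S (τ ω) ω)) μ := by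
  have hm : ∀ n, MeasurableSet {ω | τ ω = n} := fun n => by
    have := ℱ.le n _ (hτ.measurableSet_eq n)
    simpa using this
  have e : (fun ω => f (τ ω) (S (τ ω) ω)) = fun ω => ∑ n ∈ Finset.Icc k K,
      {ω | τ ω = n}.indicator (fun ω => f n (S n ω)) ω := by
    funext ω
    simp [Set.indicator_apply, hb ω]
  rw [e]
  refine integrable_finsetSum _ fun n hn => ?_
  rw [Finset.mem_Icc] at hn
  exact (h.integrable hn.1 hn.2 (f n)).indicator (hm n)

/-- Supermartingale domination of the stopped reward. -/
theorem integral_stopped_le (h : M.IsMarkovFrom μ ℱ S k)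
    (hτ : IsStoppingTime ℱ (fun ω => (τ ω : WithTop ℕ))) (hb : ∀ ω, k ≤ τ ω ∧ τ ω ≤ K)
    (f V : ℕ → M.space → ℝ)
    (h1 : ∀ n, k ≤ n → n ≤ K → ∀ᵐ ω ∂μ, τ ω = n → f n (S n ω) ≤ V n (S n ω))
    (h2 : ∀ n, k ≤ n → n < K → ∀ᵐ ω ∂μ, n + 1 ≤ τ ω →
      ∫ s, V (n + 1) s ∂(M.step n (S n ω)) ≤ V n (S n ω)) :
    ∫ ω, f (τ ω) (S (τ ω) ω) ∂μ ≤ ∫ ω, V k (S k ω) ∂μ := by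
  have hmeq : ∀ n, MeasurableSet {ω | τ ω = n} := fun n => by
    have := ℱ.le n _ (hτ.measurableSet_eq n)
    simpa using this
  have hmle : ∀ n, MeasurableSet {ω | n + 1 ≤ τ ω} := fun n =>
    ℱ.le n _ (measurableSet_le_of_lt hτ n)
  have hint := h.integrable_stopped hτ hb f
  have hsplit : ∀ n, {ω | n ≤ τ ω} = {ω | τ ω = n} ∪ {ω | n + 1 ≤ τ ω} := fun n => by
    ext ω
    simp only [Set.mem_ofPred_eq, Set.mem_union]
    omega
  have hdisj : ∀ n, Disjoint {ω | τ ω = n} {ω | n + 1 ≤ τ ω} := fun n => by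
    rw [Set.disjoint_left]
    intro ω h1 h2
    simp only [Set.mem_ofPred_eq] at h1 h2
    omega
  have heq : ∀ n, k ≤ n → n ≤ K →
      ∫ ω in {ω | τ ω = n}, f (τ ω) (S (τ ω) ω) ∂μ ≤ ∫ ω in {ω | τ ω = n}, V n (S n ω) ∂μ := by
    intro n hk hn
    refine setIntegral_mono_on_ae hint.integrableOn (h.integrable hk hn _).integrableOn (hmeq n) ?_
    filter_upwards [h1 n hk hn] with ω h1 hω
    have e : τ ω = n := hω
    rw [e]
    exact h1 e
  have key : ∀ n, n ≤ K → k ≤ n →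
      ∫ ω in {ω | n ≤ τ ω}, f (τ ω) (S (τ ω) ω) ∂μ ≤ ∫ ω in {ω | n ≤ τ ω}, V n (S n ω) ∂μ := by
    intro n hn
    induction hn using Nat.decreasingInduction with
    | self =>
      intro hk
      have e : {ω | K ≤ τ ω} = {ω | τ ω = K} := by
        ext ω
        have := (hb ω).2
        simp only [Set.mem_ofPred_eq]
        omega
      rw [e]
      exact heq K hk le_rfl
    | of_succ n hn ih =>
      intro hk
      rw [hsplit, setIntegral_union (hdisj n) (hmle n) hint.integrableOn hint.integrableOn,
        setIntegral_union (hdisj n) (hmle n) (h.integrable hk hn.le _).integrableOn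
          (h.integrable hk hn.le _).integrableOn]
      refine add_le_add (heq n hk hn.le) ((ih (by omega)).trans ?_)
      -- Not having stopped by date `n` is an event of `ℱ n`, so the one-step expectation may be
      -- taken inside it.
      rw [h.setIntegral_succ hk hn _ (measurableSet_le_of_lt hτ n)]
      refine setIntegral_mono_on_ae
        (h.integrable hk hn.le fun s => ∫ s', V (n + 1) s' ∂(M.step n s)).integrableOn
        (h.integrable hk hn.le _).integrableOn (hmle n) ?_
      filter_upwards [h2 n hk hn] with ω h2 hω using h2 hω
  by_cases hkK : k ≤ K
  · have e : {ω | k ≤ τ ω} = Set.univ := Set.eq_univ_of_forall fun ω => (hb ω).1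
    simpa [e] using key k hkK le_rfl
  · exact absurd ((hb (Classical.choice (nonempty_of_isProbabilityMeasure μ))).1.trans
      (hb _).2) hkK

end StoppingTime

theorem isStoppingTime_find {ℱ : Filtration ℕ mΩ} {P : ℕ → Ω → Prop} [∀ ω, DecidablePred (P · ω)]
    (hP : ∀ n, MeasurableSet[ℱ n] {ω | P n ω}) (hex : ∀ ω, ∃ n, P n ω) :
    IsStoppingTime ℱ (fun ω => (Nat.find (hex ω) : WithTop ℕ)) := by
  intro i
  have e : {ω | (Nat.find (hex ω) : WithTop ℕ) ≤ (i : ℕ)} = ⋃ n ∈ Set.Iic i, {ω | P n ω} := by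
    ext ω
    simp [Nat.find_le_iff]
  change MeasurableSet[ℱ i] {ω | (Nat.find (hex ω) : WithTop ℕ) ≤ (i : ℕ)}
  rw [e]
  exact MeasurableSet.biUnion (Set.to_countable _) fun n hn => ℱ.mono hn _ (hP n)

/-- The recursion dominates every stopped reward, and the first date at which the payoff reaches
`dpValue` attains it. The supremum is thus a maximum. -/
theorem stoppingValue_eq (h : M.IsMarkovFrom μ ℱ S k) (hk : k ≤ K) :
    stoppingValue μ ℱ S M.payoff k K = ∫ ω, M.dpValue k (S k ω) ∂μ := by
  classical
  refine IsGreatest.csSup_eq ⟨?_, ?_⟩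
  · have hsupp : ∀ n, ∃ A : Finset M.space, k ≤ n → n ≤ K → ∀ᵐ ω ∂μ, S n ω ∈ A := fun n => by
      by_cases hn : k ≤ n ∧ n ≤ K
      · obtain ⟨A, hA⟩ := h.exists_support hn.1 hn.2
        exact ⟨A, fun _ _ => hA⟩
      · exact ⟨∅, fun h1 h2 => absurd ⟨h1, h2⟩ hn⟩
    choose A hA using hsupp
    -- Cutting down to a finite support makes the exercise region measurable without any
    -- measurability of `dpValue`.
    let G : ℕ → Set M.space := fun n => {a | a ∈ A n ∧ M.dpValue n a ≤ M.payoff n a}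
    have hG : ∀ n, MeasurableSet (G n) := fun n =>
      ((A n).finite_toSet.subset fun a ha => ha.1).measurableSet
    let P : ℕ → Ω → Prop := fun n ω => k ≤ n ∧ (n = K ∨ n < K ∧ S n ω ∈ G n)
    have hex : ∀ ω, ∃ n, P n ω := fun ω => ⟨K, hk, Or.inl rfl⟩
    have hPm : ∀ n, MeasurableSet[ℱ n] {ω | P n ω} := by
      intro n
      by_cases hkn : k ≤ n
      · by_cases hn : n < K
        · have e : {ω | P n ω} = S n ⁻¹' G n := by
            ext ω
            simp [P, hkn, hn, hn.ne]
          rw [e]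
          exact h.adapted n hkn hn.le (hG n)
        · simp [P, hkn, hn]
      · simp [P, hkn]
    let τ : Ω → ℕ := fun ω => Nat.find (hex ω)
    have hτ : IsStoppingTime ℱ (fun ω => (τ ω : WithTop ℕ)) := isStoppingTime_find hPm hex
    have hb : ∀ ω, k ≤ τ ω ∧ τ ω ≤ K := fun ω =>
      ⟨(Nat.find_spec (hex ω)).1, Nat.find_min' (hex ω) ⟨hk, Or.inl rfl⟩⟩
    refine ⟨τ, hτ, hb, le_antisymm ?_ ?_⟩
    -- The domination lemma with signs reversed: before the optimal time `dpValue` equals the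
    -- continuation value, and at that time it is at most the payoff.
    · have := h.integral_stopped_le hτ hb (fun n s => -M.payoff n s) (fun n s => -M.dpValue n s)
        ?_ ?_
      · simpa [integral_neg] using this
      · intro n hkn hn
        refine Filter.Eventually.of_forall fun ω e => neg_le_neg ?_
        have hs := Nat.find_spec (hex ω)
        change P (τ ω) ω at hs
        rw [e] at hs
        rcases hs.2 with rfl | ⟨_, hs⟩
        · rw [M.dpValue_last]
        · exact hs.2
      · intro n hkn hn
        filter_upwards [hA n hkn hn.le] with ω hω hlt
        rw [integral_neg]
        refine neg_le_neg ?_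
        have hs : ¬ P n ω := Nat.find_min (hex ω) (Nat.lt_of_succ_le hlt)
        have hgt : M.payoff n (S n ω) < M.dpValue n (S n ω) := by
          by_contra hle
          exact hs ⟨hkn, Or.inr ⟨hn, hω, not_lt.1 hle⟩⟩
        rw [M.dpValue_of_lt hn] at hgt ⊢
        rcases le_total (M.payoff n (S n ω)) (∫ s', M.dpValue (n + 1) s' ∂(M.step n (S n ω)))
          with hle | hle
        · rw [max_eq_right hle]
        · rw [max_eq_left hle] at hgt
          exact absurd hgt (lt_irrefl _)
    · refine h.integral_stopped_le hτ hb M.payoff M.dpValue ?_ ?_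
      · exact fun n _ hn => Filter.Eventually.of_forall fun ω _ => M.payoff_le_dpValue hn _
      · exact fun n _ hn => Filter.Eventually.of_forall fun ω _ =>
          (M.dpValue_of_lt hn (S n ω)).symm ▸ le_max_right _ _
  · rintro v ⟨τ, hτ, hb, rfl⟩
    refine h.integral_stopped_le hτ hb M.payoff M.dpValue ?_ ?_
    · exact fun n _ hn => Filter.Eventually.of_forall fun ω _ => M.payoff_le_dpValue hn _
    · exact fun n _ hn => Filter.Eventually.of_forall fun ω _ =>
        (M.dpValue_of_lt hn (S n ω)).symm ▸ le_max_right _ _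

end IsMarkovFrom

/-! ### The chain restarted at a given date -/

theorem pathLaw_apply_eq (k : ℕ) (s : M.space) : ∀ᵐ x ∂(M.pathLaw k s), x k = s := by
  have h := DFunLike.congr_fun (Kernel.traj_map_frestrictLe_of_le (X := fun _ => M.space)
    (κ := M.historyStep) (le_refl k)) (fun _ => s)
  rw [Kernel.map_apply _ (by fun_prop), Kernel.deterministic_apply] at h
  have h1 : ∀ᵐ y ∂((M.pathLaw k s).map (Preorder.frestrictLe (π := fun _ => M.space) k)),
      y ⟨k, Finset.mem_Iic.2 le_rfl⟩ = s := by
    rw [pathLaw, h, ae_dirac_iff]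
    · rfl
    · exact (measurable_pi_apply (X := fun _ : Finset.Iic k => M.space)
        ⟨k, Finset.mem_Iic.2 le_rfl⟩) (measurableSet_singleton s)
  exact ae_of_ae_map (by fun_prop) h1

instance (k : ℕ) (s : M.space) : IsProbabilityMeasure (M.pathLaw k s) := by
  unfold pathLaw
  infer_instance

theorem isMarkovFrom_pathLaw (k : ℕ) (s : M.space) :
    M.IsMarkovFrom (M.pathLaw k s) (Filtration.piLE (X := fun _ => M.space))
      (fun n x => x n) k where
  adapted n _ _ := by
    rw [Filtration.piLE_eq_comap_frestrictLe]
    exact (measurable_pi_apply (X := fun _ : Finset.Iic n => M.space)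
      ⟨n, Finset.mem_Iic.2 le_rfl⟩).comp (comap_measurable _)
  start := ⟨{s}, by simpa using M.pathLaw_apply_eq k s⟩
  markov_property n hk hn A hA := by
    have hm : MeasurableSet ((fun x : ℕ → M.space => x (n + 1)) ⁻¹' A) :=
      measurable_pi_apply (n + 1) hA
    have h := Kernel.condExp_traj (X := fun _ => M.space) (κ := M.historyStep) hk
      (x₀ := fun _ => s) (f := ((fun x : ℕ → M.space => x (n + 1)) ⁻¹' A).indicator
        (fun _ => (1 : ℝ))) ((integrable_const _).indicator hm)
    refine h.trans (Filter.Eventually.of_forall fun x => ?_)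
    have h2 := DFunLike.congr_fun (Kernel.map_traj_succ_self (X := fun _ => M.space)
      (κ := M.historyStep) (a := n)) (Preorder.frestrictLe (π := fun _ => M.space) n x)
    rw [Kernel.map_apply _ (by fun_prop)] at h2
    beta_reduce
    rw [integral_indicator_const _ hm, smul_eq_mul, mul_one,
      ← map_measureReal_apply (by fun_prop) hA, h2]
    rfl

/-- Links the values `V_k` of the out-of-boundary hypothesis, defined on path space, to the
recursion that also prices the option on `Ω`. -/
theorem value_eq_dpValue {k : ℕ} (hk : k ≤ K) (s : M.space) : M.value k s = M.dpValue k s := by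
  rw [value, (M.isMarkovFrom_pathLaw k s).stoppingValue_eq hk]
  have : ∀ᵐ x ∂(M.pathLaw k s), M.dpValue k (x k) = M.dpValue k s := by
    filter_upwards [M.pathLaw_apply_eq k s] with x hx
    rw [hx]
  rw [integral_congr_ae this]
  simp

theorem IsPriceModel.isMarkovFrom {M : Market d K} {Ω : Type*} {mΩ : MeasurableSpace Ω}
    {μ : Measure Ω} {ℱ : Filtration ℕ mΩ} {S : ℕ → Ω → M.space} {s₀ : M.space}
    (h : M.IsPriceModel μ ℱ S s₀) : M.IsMarkovFrom μ ℱ S 0 where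
  adapted n _ hn := h.adapted n hn
  start := ⟨{s₀}, by simpa using h.init⟩
  markov_property n _ hn := h.markov_property n hn

end Market

/-! ### Propagation of the errors -/

theorem abs_integral_sub_le {E : Type*} [MeasurableSpace E] {ν : Measure E}
    [IsProbabilityMeasure ν] {f g : E → ℝ} {ε : ℝ} (hf : Integrable f ν) (hg : Integrable g ν)
    (h : ∀ x, |f x - g x| ≤ ε) : |∫ x, f x ∂ν - ∫ x, g x ∂ν| ≤ ε := by
  rw [← integral_sub hf hg]
  simpa using norm_integral_le_of_norm_le_const (μ := ν) (f := fun x => f x - g x)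
    (Filter.Eventually.of_forall h)

theorem Box.clamp_of_mem {d : ℕ} (D : Box d) {s : Fin d → ℝ} (hs : s ∈ D.toSet) :
    D.clamp s = s := by
  funext i
  rw [Box.clamp, max_eq_right (hs i).1, min_eq_right (hs i).2]

theorem Box.chebInterp_sub {d : ℕ} (D : Box d) (m : ℕ) (v w : (Fin d → Fin (m + 1)) → ℝ)
    (s : Fin d → ℝ) :
    D.chebInterp m v s - D.chebInterp m w s = D.chebInterp m (fun j => v j - w j) s := by
  simp only [D.chebInterp_eq_sum, sub_mul, Finset.sum_sub_distrib]

theorem Box.abs_sub_chebInterp_le_epsInt_add {d : ℕ} (D : Box d) {ρ B ε : ℝ} {g : D.toSet → ℝ}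
    {m : ℕ} (h : HasBoundedAnalyticExtension D ρ B g) (hρ : 1 < ρ) (hd : 0 < d) (hm : 1 ≤ m)
    {v : (Fin d → Fin (m + 1)) → ℝ} (hv : ∀ j, |g ⟨D.node m j, D.node_mem m j⟩ - v j| ≤ ε)
    (x : D.toSet) : |g x - D.chebInterp m v x| ≤ epsInt ρ d m B + lebesgueFactor d m * ε := by
  have h1 := D.abs_sub_chebInterp_le_epsInt h hρ hd hm x
  have h2 := D.abs_chebInterp_le m _ hv x.2
  rw [← D.chebInterp_sub m] at h2
  exact (abs_sub_le _ _ _).trans (add_le_add h1 h2)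

namespace Market

variable {d K : ℕ} (M : Market d K)

theorem integrable_step {k : ℕ} (hk : k < K) (s : M.space) (φ : M.space → ℝ) :
    Integrable φ (M.step k s) := by
  have := M.markov k
  obtain ⟨A, hA⟩ := M.finite_step k hk s
  exact integrable_comp_of_mem_finset measurable_id (A := A) (by rw [ae_iff]; exact hA) φ

end Market

namespace Run

variable {d K : ℕ} {M : Market d K} (R : Run M) {εOB εQAE ρ B : ℕ → ℝ}

theorem GV_last : R.GV K = M.payoff K := by
  funext s
  simp [GV]

/-- Inside the box only `η` is incurred, on `A k` only `ε`; elsewhere the flat extrapolation incurs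
both, through the value at the clamped point. -/
theorem abs_GV_sub_dpValue_le_of_lt {k : ℕ} (hk : 1 ≤ k ∧ k < K) {ε η : ℝ} (hε : 0 ≤ ε)
    (hOB : R.OutOfBoundaryAccuracy k hk ε)
    (hV : ∀ x, |R.Vtilde hk x - M.dpValue k (R.incl hk x)| ≤ η) (s : M.space) :
    |R.GV k s - M.dpValue k s| ≤ ε + η := by
  have hη : 0 ≤ η := (abs_nonneg _).trans (hV (R.clamp k s))
  have hGV : R.GV k s = R.extrap k (R.Vtilde hk) s := dif_pos hk
  have hval : ∀ x, M.value k x = M.dpValue k x := fun x => M.value_eq_dpValue hk.2.le x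
  rw [hGV, extrap]
  by_cases hs : (s : Fin d → ℝ) ∈ (R.D k).toSet
  · have hA : s ∉ R.A k := fun h => R.A_outside k hk.1 hk.2 s h hs
    have hc : R.incl hk (R.clamp k s) = s := Subtype.ext ((R.D k).clamp_of_mem hs)
    have := hV (R.clamp k s)
    rw [hc] at this
    rw [if_neg hA, flat]
    linarith
  · obtain ⟨h1, h2⟩ := hOB s hs
    by_cases hA : s ∈ R.A k
    · have := h1 hA
      rw [hval] at this
      rw [if_pos hA]
      linarith
    · have h3 := h2 hA
      rw [flat, hval, hval] at h3
      rw [if_neg hA, flat]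
      have h4 := abs_sub_le (R.Vtilde hk (R.clamp k s))
        (M.dpValue k (R.incl hk (R.clamp k s))) (M.dpValue k s)
      linarith [hV (R.clamp k s)]

/-- Backward induction. The later error enters through an expectation, which does not enlarge it;
interpolation adds `epsInt` plus the amplified node errors. Interpolation is compared with `Qhat`,
the function assumed analytic, so later errors are not multiplied by the Lebesgue constant. -/
theorem abs_GV_sub_dpValue_le (hd : 0 < d)
    (hεOB : ∀ k, 1 ≤ k → k < K → 0 ≤ εOB k)
    (hOB : ∀ k (hk : 1 ≤ k ∧ k < K), R.OutOfBoundaryAccuracy k hk (εOB k))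
    (hρ : ∀ k, 1 ≤ k → k < K → 1 < ρ k)
    (hQ : ∀ k (hk : 1 ≤ k ∧ k < K), HasBoundedAnalyticExtension (R.D k) (ρ k) (B k)
      (fun s => R.Qhat k (R.incl hk s)))
    (hQAE : ∀ k (hk : 1 ≤ k ∧ k < K) (j : Fin d → Fin (R.m k + 1)),
      |R.Qhat k (R.incl hk ⟨(R.D k).node (R.m k) j, (R.D k).node_mem (R.m k) j⟩) - R.QQAE k j|
        ≤ εQAE k) {k : ℕ} (hkK : k ≤ K) (hk1 : 1 ≤ k) (s : M.space) :
    |R.GV k s - M.dpValue k s| ≤ ∑ j ∈ Finset.Ico k K,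
      (εOB j + (epsInt (ρ j) d (R.m j) (B j) + lebesgueFactor d (R.m j) * εQAE j)) := by
  induction hkK using Nat.decreasingInduction generalizing s with
  | self => simp [R.GV_last, M.dpValue_last]
  | of_succ k hkK ih =>
    have hk : 1 ≤ k ∧ k < K := ⟨hk1, hkK⟩
    have := M.markov k
    rw [Finset.sum_eq_sum_Ico_succ_bot hkK, add_assoc]
    refine R.abs_GV_sub_dpValue_le_of_lt hk (hεOB k hk1 hkK) (hOB k hk) (fun x => ?_) s
    have h1 : |R.Qhat k (R.incl hk x) - ∫ s', M.dpValue (k + 1) s' ∂(M.step k (R.incl hk x))| ≤ _ :=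
      abs_integral_sub_le (M.integrable_step hkK _ _) (M.integrable_step hkK _ _)
        (ih (Nat.le_add_left 1 k))
    have h2 := (R.D k).abs_sub_chebInterp_le_epsInt_add (hQ k hk) (hρ k hk1 hkK) hd
      (R.m_pos k hk1 hkK) (hQAE k hk) x
    rw [abs_sub_comm] at h2
    rw [M.dpValue_of_lt hkK, Vtilde, max_comm (M.payoff k _), max_comm (M.payoff k _)]
    exact (abs_max_sub_max_le_abs _ _ _).trans ((abs_sub_le _ _ _).trans (add_le_add h2 h1))

end Run

end Bermudan

end

/-! ### The total error at the present date -/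

theorem theorem4 {d K : ℕ} (hd : 0 < d) (hK : 0 < K)
    -- the option, and its underlying process on a filtered probability space
    (M : Bermudan.Market d K)
    {Ω : Type*} {mΩ : MeasurableSpace Ω} (μ : Measure Ω) [IsProbabilityMeasure μ]
    (ℱ : Filtration ℕ mΩ) (S : ℕ → Ω → M.space) (s₀ : M.space)
    (hS : M.IsPriceModel μ ℱ S s₀)
    -- the run of the algorithm
    (R : Bermudan.Run M)
    (εOB εQAE ρ B : ℕ → ℝ)
    -- out-of-boundary approximation
    (hεOB : ∀ k, 1 ≤ k → k < K → 0 ≤ εOB k)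
    (hOB : ∀ k (hk : 1 ≤ k ∧ k < K), R.OutOfBoundaryAccuracy k hk (εOB k))
    -- bounded analytic extension of the approximate continuation values
    (hρ : ∀ k, 1 ≤ k → k < K → 1 < ρ k)
    (hQ : ∀ k (hk : 1 ≤ k ∧ k < K),
      Bermudan.HasBoundedAnalyticExtension (R.D k) (ρ k) (B k)
        (fun s => R.Qhat k (R.incl hk s)))
    -- accuracy of the amplitude estimations
    (hQAE : ∀ k (hk : 1 ≤ k ∧ k < K) (j : Fin d → Fin (R.m k + 1)),
      |R.Qhat k (R.incl hk ⟨(R.D k).node (R.m k) j, (R.D k).node_mem (R.m k) j⟩) - R.QQAE k j|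
        ≤ εQAE k)
    (hQAE₀ : |(∫ ω, R.GV 1 (S 1 ω) ∂μ) - R.output| ≤ εQAE 0) :
    |Bermudan.stoppingValue μ ℱ S M.payoff 1 K - R.output| ≤
      ∑ k ∈ Finset.Ico 1 K, εOB k
        + ∑ k ∈ Finset.Ico 1 K, Bermudan.epsInt (ρ k) d (R.m k) (B k)
        + (εQAE 0 + ∑ k ∈ Finset.Ico 1 K, Bermudan.lebesgueFactor d (R.m k) * εQAE k) := by
  -- Exercise starts at date `1`, so the process is viewed from there; `S 1` is random but has
  -- finite support.
  have h0 := hS.isMarkovFrom.of_le (Nat.zero_le 1) hK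
  rw [h0.stoppingValue_eq hK]
  have h1 := Bermudan.abs_integral_sub_le (ν := μ) (h0.integrable le_rfl hK _)
    (h0.integrable le_rfl hK _)
    (fun ω => R.abs_GV_sub_dpValue_le hd hεOB hOB hρ hQ hQAE hK le_rfl (S 1 ω))
  rw [abs_sub_comm] at h1
  refine (abs_sub_le _ _ _).trans ((add_le_add h1 hQAE₀).trans (le_of_eq ?_))
  rw [Finset.sum_add_distrib, Finset.sum_add_distrib]
  ring
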